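/- **Setting.** Let $\mathcal A:\mathbb R^n\to\mathbb R^m$ be linear, $b\in\mathbb R^m$, $\lambda_1,\lambda_2\ge 0$ with $\lambda_1+\lambda_2>0$, $w_1,\dots,w_g>0$, and let $G_1,\dots,G_g$ be a partition of $\{1,\dots,n\}$. Write $\mathcal P_l x=x_{G_l}$ and put $$\varphi(x)=\lambda_1\|x\|_1,\qquad p(x)=\lambda_1\|x\|_1+\lambda_2\sum_{l=1}^g w_l\|x_{G_l}\| .$$ Let $p^*$ be the Fenchel conjugate of $p$, and let $\operatorname{Prox}_h(u)=\arg\min_x\{h(x)+\tfrac12\|x-u\|^2\}$. Let $\Pi_l$ be the metric projection of $\mathbb R^{|G_l|}$ onto the closed ball of radius $\lambda_2 w_l$ centred at $0$. For a locally Lipschitz map $F$ let $\partial F(x)$ be its Clarke generalized Jacobian at $x$ (the convex hull of the limits of Jacobians $F'(x_k)$ over sequences $x_k\to x$ of points of differentiability). For $u\in\mathbb R^n$ let $$\mathcal M(u)=\Big\{\Big(I-\sum_{l=1}^g\mathcal P_l^*\Sigma_l\mathcal P_l\Big)\Theta \;:\; \Theta\in\partial\operatorname{Prox}_\varphi(u),\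 \Sigma_l\in\partial\Pi_l(v_{G_l})\ (1\le l\le g),\ v=\operatorname{Prox}_\varphi(u)\Big\}.$$ Fix $\sigma>0$ and $\tilde x\in\mathbb R^n$. The augmented Lagrangian subproblem is $\min_{y\in\mathbb R^m}\psi(y)$ with $$\psi(y)=\langle b,y\rangle+\tfrac12\|y\|^2+p^*\big(\operatorname{Prox}_{p^*/\sigma}(\sigma^{-1}\tilde x-\mathcal A^*y)\big)+\tfrac{\sigma}{2}\big\|\operatorname{Prox}_p(\sigma^{-1}\tilde x-\mathcal A^*y)\big\|^2 .$$ **Algorithm.** Given $\mu\in(0,\tfrac12)$, $\bar\eta\in(0,1)$, $\tau\in(0,1]$, $\delta\in(0,1)$ and $y^0\in\mathbb R^m$, iterate for $j=0,1,2,\dots$: 1. Choose $M_j\in\mathcal M(\sigma^{-1}\tilde x-\mathcal A^*y^j)$ and let $V_j=I+\sigma\mathcal A M_j\mathcal A^*$. Let $d^j$ be the exact solution of $V_jd=-\nabla\psi(y^j)$, or any iterate of the conjugate gradient method for this system, started from $d=0$, such that $\|V_jd^j+\nabla\psi(y^j)\|\le\min\big(\bar\eta,\|\nabla\psi(y^j)\|^{1+\tau}\big)$.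 2. Let $m_j$ be the smallest integer $i\ge 0$ with $\psi(y^j+\delta^i d^j)\le\psi(y^j)+\mu\,\delta^i\langle\nabla\psi(y^j),d^j\rangle$, and put $\alpha_j=\delta^{m_j}$. 3. Put $y^{j+1}=y^j+\alpha_jd^j$. **Theorem 4.2.** The function $\psi$ is finite and differentiable on $\mathbb R^m$, and the algorithm is well defined: at every point $y^j$ one has $\mathcal M(\sigma^{-1}\tilde x-\mathcal A^*y^j)\ne\emptyset$; for every choice of $M_j$ the linear system $V_jd=-\nabla\psi(y^j)$ has exactly one solution and some conjugate gradient iterate meets the accuracy test; and for every admissible $d^j$ an integer $m_j$ as in step 2 exists. Hence for every $y^0$ the algorithm generates an infinite sequence. The subproblem has a unique minimizer $\bar y$, and every sequence $\{y^j\}$ generated by the algorithm converges to $\bar y$ with $$\|y^{j+1}-\bar y\|=O\big(\|y^j-\bar y\|^{1+\tau}\big)\qquad(j\to\infty).$$ -/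

import Mathlib

open scoped InnerProduct
open Filter Topology

noncomputable section

/-! # General notions -/

/-- `IsProx h u x`: the point `x` minimizes `h(x) + ‖x - u‖² / 2`. -/
def IsProx {E : Type*} [NormedAddCommGroup E] (h : E → EReal) (u x : E) : Prop :=
  ∀ x' : E, h x + (((1 / 2 : ℝ) * ‖x - u‖ ^ 2 : ℝ) : EReal)
    ≤ h x' + (((1 / 2 : ℝ) * ‖x' - u‖ ^ 2 : ℝ) : EReal)

/-- The proximal mapping `Prox_h(u) = argmin_x { h(x) + ‖x - u‖² / 2 }` of an extended real valued
function. For a closed proper convex `h` on a Euclidean space the minimizer exists and is unique. -/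
def prox {E : Type*} [NormedAddCommGroup E] (h : E → EReal) (u : E) : E :=
  Classical.epsilon (IsProx h u)

/-- The Fenchel conjugate `p*(z) = sup_x { ⟨x, z⟩ - p(x) }` of a finite valued function. -/
def conjugate {E : Type*} [NormedAddCommGroup E] [InnerProductSpace ℝ E]
    (p : E → ℝ) (z : E) : EReal :=
  ⨆ x : E, ((inner ℝ x z - p x : ℝ) : EReal)

/-- `IsProj C u x`: the point `x` is a point of `C` nearest to `u`. -/
def IsProj {E : Type*} [NormedAddCommGroup E] (C : Set E) (u x : E) : Prop :=
  x ∈ C ∧ ∀ x' ∈ C, ‖u - x‖ ≤ ‖u - x'‖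

/-- The metric projection onto `C`. For a nonempty closed convex set in a Euclidean space the
nearest point exists and is unique. -/
def metricProj {E : Type*} [NormedAddCommGroup E] (C : Set E) (u : E) : E :=
  Classical.epsilon (IsProj C u)

/-- The Clarke generalized Jacobian `∂F(x)`: the convex hull of all limits of Jacobians `F'(x_k)`
along sequences `x_k → x` of points at which `F` is differentiable. -/
def clarkeJacobian {E F : Type*} [NormedAddCommGroup E] [NormedSpace ℝ E]
    [NormedAddCommGroup F] [NormedSpace ℝ F] (f : E → F) (x : E) : Set (E →L[ℝ] F) :=
  convexHull ℝ {L | ∃ u : ℕ → E, (∀ k, DifferentiableAt ℝ f (u k)) ∧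
    Tendsto u atTop (𝓝 x) ∧ Tendsto (fun k => fderiv ℝ f (u k)) atTop (𝓝 L)}

/-! # The conjugate gradient method -/

/-- The state of the conjugate gradient method: iterate, residual, search direction. -/
structure CGState (E : Type*) where
  x : E
  r : E
  q : E

/-- One step of the conjugate gradient method for a system with operator `V`. Once the residual is
zero the iterate no longer changes (the divisions are then `0 / 0 = 0`). -/
def cgStep {E : Type*} [NormedAddCommGroup E] [InnerProductSpace ℝ E]
    (V : E →L[ℝ] E) (s : CGState E) : CGState E :=
  let a : ℝ := ‖s.r‖ ^ 2 / inner ℝ s.q (V s.q)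
  let r' : E := s.r - a • V s.q
  { x := s.x + a • s.q
    r := r'
    q := r' + (‖r'‖ ^ 2 / ‖s.r‖ ^ 2) • s.q }

/-- The `k`-th iterate of the conjugate gradient method for `V d = c`, started at `d = 0`. -/
def cgIterate {E : Type*} [NormedAddCommGroup E] [InnerProductSpace ℝ E]
    (V : E →L[ℝ] E) (c : E) (k : ℕ) : E :=
  ((cgStep V)^[k] { x := 0, r := c, q := c }).x

/-! # The sparse group Lasso problem and its ALM subproblem -/

/-- The data of a sparse group Lasso problem
`min_x ‖A x - b‖² / 2 + lam1 ‖x‖₁ + lam2 ∑_l w_l ‖x_{G_l}‖`. -/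
structure SGLasso (m n g : ℕ) where
  A : EuclideanSpace ℝ (Fin n) →L[ℝ] EuclideanSpace ℝ (Fin m)
  b : EuclideanSpace ℝ (Fin m)
  lam1 : ℝ
  lam2 : ℝ
  w : Fin g → ℝ
  G : Fin g → Finset (Fin n)

/-- The restriction `x ↦ x_G` to the coordinates in `G`. -/
def restrictTo {n : ℕ} (G : Finset (Fin n)) :
    EuclideanSpace ℝ (Fin n) →L[ℝ] EuclideanSpace ℝ {i // i ∈ G} :=
  LinearMap.toContinuousLinearMap
    { toFun := fun x => WithLp.toLp 2 (fun i => x i.1)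
      map_add' := fun x y => by ext i; simp
      map_smul' := fun c x => by ext i; simp }

namespace SGLasso

variable {m n g : ℕ} (S : SGLasso m n g)

/-- The standing assumptions on the data: nonnegative parameters that are not both zero, positive
weights, and groups that form a partition of the set of all indices. -/
structure Admissible : Prop where
  lam1_nonneg : 0 ≤ S.lam1
  lam2_nonneg : 0 ≤ S.lam2
  lam_pos : 0 < S.lam1 + S.lam2
  w_pos : ∀ l, 0 < S.w l
  disjoint : ∀ i j, i ≠ j → Disjoint (S.G i) (S.G j)
  cover : ∀ i, ∃ l, i ∈ S.G l

/-- `varphi(x) = lam1 ‖x‖₁`. -/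
def varphi (x : EuclideanSpace ℝ (Fin n)) : ℝ := S.lam1 * ∑ i, |x i|

/-- `p(x) = lam1 ‖x‖₁ + lam2 ∑_l w_l ‖x_{G_l}‖`. -/
def p (x : EuclideanSpace ℝ (Fin n)) : ℝ :=
  S.varphi x + S.lam2 * ∑ l, S.w l * ‖restrictTo (S.G l) x‖

/-- `Prox_varphi`. -/
def proxVarphi (u : EuclideanSpace ℝ (Fin n)) : EuclideanSpace ℝ (Fin n) :=
  prox (fun x => (S.varphi x : EReal)) u

/-- `Prox_p`. -/
def proxP (u : EuclideanSpace ℝ (Fin n)) : EuclideanSpace ℝ (Fin n) :=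
  prox (fun x => (S.p x : EReal)) u

/-- `Prox_{p* / σ}`. -/
def proxConj (σ : ℝ) (u : EuclideanSpace ℝ (Fin n)) : EuclideanSpace ℝ (Fin n) :=
  prox (fun z => ((σ⁻¹ : ℝ) : EReal) * conjugate S.p z) u

/-- The projection onto the ball `{u ∈ ℝ^{G_l} | ‖u‖ ≤ lam2 w_l}`. -/
def projBall (l : Fin g) :
    EuclideanSpace ℝ {i // i ∈ S.G l} → EuclideanSpace ℝ {i // i ∈ S.G l} :=
  metricProj (Metric.closedBall 0 (S.lam2 * S.w l))

/-- The surrogate generalized Jacobian of `Prox_p` at `u`: the set of all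
`(I - ∑_l P_l* Σ_l P_l) Θ` with `Θ ∈ ∂ Prox_varphi(u)` and `Σ_l ∈ ∂ Π_l(v_{G_l})`, where
`v = Prox_varphi(u)`, `P_l x = x_{G_l}` and `Π_l` is the projection onto the `l`-th ball. -/
def surrogateJacobian (u : EuclideanSpace ℝ (Fin n)) :
    Set (EuclideanSpace ℝ (Fin n) →L[ℝ] EuclideanSpace ℝ (Fin n)) :=
  {M | ∃ (Sig : ∀ l, EuclideanSpace ℝ {i // i ∈ S.G l} →L[ℝ] EuclideanSpace ℝ {i // i ∈ S.G l})
      (Th : EuclideanSpace ℝ (Fin n) →L[ℝ] EuclideanSpace ℝ (Fin n)),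
      (∀ l, Sig l ∈ clarkeJacobian (S.projBall l) (restrictTo (S.G l) (S.proxVarphi u))) ∧
      Th ∈ clarkeJacobian S.proxVarphi u ∧
      M = (ContinuousLinearMap.id ℝ _ - ∑ l, (ContinuousLinearMap.adjoint (restrictTo (S.G l))) ∘L
            (Sig l) ∘L (restrictTo (S.G l))) ∘L Th}

/-- The point `σ⁻¹ xt - A* y`. -/
def shifted (σ : ℝ) (xt : EuclideanSpace ℝ (Fin n)) (y : EuclideanSpace ℝ (Fin m)) :
    EuclideanSpace ℝ (Fin n) :=
  σ⁻¹ • xt - ContinuousLinearMap.adjoint S.A y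

/-- The objective of the subproblem, with `u = σ⁻¹ xt - A* y`, as an extended real number:
`⟨b, y⟩ + ‖y‖² / 2 + p*(Prox_{p* / σ}(u)) + (σ / 2) ‖Prox_p(u)‖²`. -/
def psiE (σ : ℝ) (xt : EuclideanSpace ℝ (Fin n)) (y : EuclideanSpace ℝ (Fin m)) : EReal :=
  ((inner ℝ S.b y + (1 / 2 : ℝ) * ‖y‖ ^ 2 : ℝ) : EReal)
    + conjugate S.p (S.proxConj σ (S.shifted σ xt y))
    + ((σ / 2 * ‖S.proxP (S.shifted σ xt y)‖ ^ 2 : ℝ) : EReal)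

/-- The objective of the subproblem as a real valued function. That `psiE` takes finite values only
is part of what is claimed about it. -/
def psi (σ : ℝ) (xt : EuclideanSpace ℝ (Fin n)) (y : EuclideanSpace ℝ (Fin m)) : ℝ :=
  (S.psiE σ xt y).toReal

/-! # The semismooth Newton method -/

/-- `V = I + σ A M A*`. -/
def newtonOp (σ : ℝ) (M : EuclideanSpace ℝ (Fin n) →L[ℝ] EuclideanSpace ℝ (Fin n)) :
    EuclideanSpace ℝ (Fin m) →L[ℝ] EuclideanSpace ℝ (Fin m) :=
  ContinuousLinearMap.id ℝ _ + σ • (S.A ∘L M ∘L ContinuousLinearMap.adjoint S.A)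

/-- The accuracy test `‖V d + ∇ψ(y)‖ ≤ min(η, ‖∇ψ(y)‖^(1+τ))` for a direction `d`. -/
def Accurate (σ : ℝ) (xt : EuclideanSpace ℝ (Fin n)) (η τ : ℝ) (y : EuclideanSpace ℝ (Fin m))
    (M : EuclideanSpace ℝ (Fin n) →L[ℝ] EuclideanSpace ℝ (Fin n))
    (d : EuclideanSpace ℝ (Fin m)) : Prop :=
  ‖S.newtonOp σ M d + gradient (S.psi σ xt) y‖
    ≤ min η (‖gradient (S.psi σ xt) y‖ ^ (1 + τ))

/-- The directions that Step 1 may return at `y` when `M` was chosen: an exact solution of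
`V d = -∇ψ(y)`, or an iterate of the conjugate gradient method for this system which passes the
accuracy test (an exact solution always passes it). -/
def IsDirection (σ : ℝ) (xt : EuclideanSpace ℝ (Fin n)) (η τ : ℝ) (y : EuclideanSpace ℝ (Fin m))
    (M : EuclideanSpace ℝ (Fin n) →L[ℝ] EuclideanSpace ℝ (Fin n))
    (d : EuclideanSpace ℝ (Fin m)) : Prop :=
  (S.newtonOp σ M d = -gradient (S.psi σ xt) y ∨
    ∃ k, d = cgIterate (S.newtonOp σ M) (-gradient (S.psi σ xt) y) k) ∧
  S.Accurate σ xt η τ y M d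

/-- The Armijo condition `ψ(y + δ^i d) ≤ ψ(y) + μ δ^i ⟨∇ψ(y), d⟩`. -/
def Armijo (σ : ℝ) (xt : EuclideanSpace ℝ (Fin n)) (μ δ : ℝ) (y d : EuclideanSpace ℝ (Fin m))
    (i : ℕ) : Prop :=
  S.psi σ xt (y + δ ^ i • d)
    ≤ S.psi σ xt y + μ * δ ^ i * inner ℝ (gradient (S.psi σ xt) y) d

/-- `y'` can result from one iteration of the semismooth Newton method at `y`. -/
def IsNewtonStep (σ : ℝ) (xt : EuclideanSpace ℝ (Fin n)) (μ η τ δ : ℝ)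
    (y y' : EuclideanSpace ℝ (Fin m)) : Prop :=
  ∃ M ∈ S.surrogateJacobian (S.shifted σ xt y), ∃ d, S.IsDirection σ xt η τ y M d ∧
    ∃ i : ℕ, IsLeast {i | S.Armijo σ xt μ δ y d i} i ∧ y' = y + δ ^ i • d

/-- `y 0, y 1, …` is a sequence generated by the semismooth Newton method. -/
def IsNewtonSequence (σ : ℝ) (xt : EuclideanSpace ℝ (Fin n)) (μ η τ δ : ℝ)
    (y : ℕ → EuclideanSpace ℝ (Fin m)) : Prop :=
  ∀ j, S.IsNewtonStep σ xt μ η τ δ (y j) (y (j + 1))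

end SGLasso

end

/-! Since `p` is positively homogeneous, `p*` is the indicator function of the set of `z` with ⟨x,
z⟩ ≤ p(x) for all x. The point `Prox_{p*/σ}(u) = u - Prox_p(u)` lies in that set, so the conjugate
term of `ψ` vanishes and ψ(y) = ⟨b, y⟩ + ‖y‖²/2 + (σ/2)‖Prox_p(u)‖² with u = σ⁻¹x̃ - A*y. Half the
squared norm of `Prox_p` is convex with the nonexpansive gradient `Prox_p`. Hence `ψ` is strongly
convex with modulus one and has a Lipschitz gradient (`Admissible.stronglyConvexSmooth_psi`); this
yields differentiability and the unique minimizer.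

Every surrogate Jacobian `M` is symmetric and positive semidefinite
(`Admissible.exists_inner_surrogate`), so V = I + σAMA* dominates the identity and conjugate
gradients terminate. Every conjugate gradient iterate is orthogonal to its residual
(`inner_cgIterate`), hence ⟨∇ψ, d⟩ = -⟨d, Vd⟩ ≤ -‖d‖², however early the method is stopped. The line
search therefore ends, accepted steps are bounded below, and each iteration lowers `ψ` by a fixed
multiple of ‖∇ψ‖². This gives global convergence.

The local rate rests on two expansions of `Prox_p`, both computed from closed forms. Soft
thresholding is piecewise linear and contributes no error. For projections onto balls, polar
coordinates give strong semismoothness (`ballProj_semismooth`), so that a full step leaves an error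
of order 1 + τ, and a trapezoidal rule with cubic error (`ballProj_trapezoid`). The latter shows
that `ψ` behaves like a quadratic to second order, so that any μ < 1/2 eventually accepts the unit
step. -/

noncomputable section

/-! # The conjugate gradient method -/

section ConjugateGradient

variable {E : Type*} [NormedAddCommGroup E] [InnerProductSpace ℝ E]

/-- The state of the conjugate gradient method for `V d = c` after `k` steps. -/
def cgState (V : E →L[ℝ] E) (c : E) (k : ℕ) : CGState E :=
  (cgStep V)^[k] { x := 0, r := c, q := c }

/-- The step length of the conjugate gradient method. -/
def cgLength (V : E →L[ℝ] E) (s : CGState E) : ℝ := ‖s.r‖ ^ 2 / inner ℝ s.q (V s.q)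

/-- The coefficient by which the conjugate gradient method updates the search direction. -/
def cgCoeff (V : E →L[ℝ] E) (s : CGState E) : ℝ := ‖(cgStep V s).r‖ ^ 2 / ‖s.r‖ ^ 2

variable (V : E →L[ℝ] E) (c : E)

lemma cgState_zero : cgState V c 0 = { x := 0, r := c, q := c } := rfl

lemma cgState_succ (k : ℕ) : cgState V c (k + 1) = cgStep V (cgState V c k) :=
  Function.iterate_succ_apply' _ _ _

lemma cgState_succ_x (k : ℕ) : (cgState V c (k + 1)).x =
    (cgState V c k).x + cgLength V (cgState V c k) • (cgState V c k).q := by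
  rw [cgState_succ]; rfl

lemma cgState_succ_r (k : ℕ) : (cgState V c (k + 1)).r =
    (cgState V c k).r - cgLength V (cgState V c k) • V (cgState V c k).q := by
  rw [cgState_succ]; rfl

lemma cgState_succ_q (k : ℕ) : (cgState V c (k + 1)).q =
    (cgState V c (k + 1)).r + cgCoeff V (cgState V c k) • (cgState V c k).q := by
  rw [cgState_succ]; rfl

lemma cgState_r_eq (k : ℕ) : (cgState V c k).r = c - V (cgState V c k).x := by
  induction k with
  | zero => simp [cgState_zero]
  | succ k ih => rw [cgState_succ_r, cgState_succ_x, ih]; simp [sub_sub]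

lemma cgState_x_eq_sum (k : ℕ) : (cgState V c k).x =
    ∑ i ∈ Finset.range k, cgLength V (cgState V c i) • (cgState V c i).q := by
  induction k with
  | zero => simp [cgState_zero]
  | succ k ih => rw [Finset.sum_range_succ, ← ih, cgState_succ_x]

lemma cgState_succ_r_eq_zero {k : ℕ} (h : (cgState V c k).r = 0) :
    (cgState V c (k + 1)).r = 0 := by
  rw [cgState_succ_r, cgLength, h]; simp

lemma cgState_r_eq_zero_of_le {i k : ℕ} (hik : i ≤ k) (h : (cgState V c i).r = 0) :
    (cgState V c k).r = 0 := by
  induction k, hik using Nat.le_induction with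
  | base => exact h
  | succ k _ ih => exact cgState_succ_r_eq_zero V c ih

/-- Division-free form of the coefficient; it survives termination because a zero residual stays
zero. -/
lemma cgCoeff_mul (k : ℕ) : cgCoeff V (cgState V c k) * ‖(cgState V c k).r‖ ^ 2 =
    ‖(cgState V c (k + 1)).r‖ ^ 2 := by
  rw [cgCoeff, ← cgState_succ]
  by_cases h : (cgState V c k).r = 0
  · rw [cgState_succ_r_eq_zero V c h, h]; simp
  · have : ‖(cgState V c k).r‖ ≠ 0 := by simpa using h
    field_simp

variable {V} (hsymm : ∀ x y, inner ℝ (V x) y = inner ℝ x (V y))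
  (hpos : ∀ x, ‖x‖ ^ 2 ≤ inner ℝ x (V x))

/-- The orthogonality relations of the conjugate gradient method. -/
structure CGInvariant (V : E →L[ℝ] E) (c : E) (k : ℕ) : Prop where
  residual : ∀ i < k, inner ℝ (cgState V c k).r (cgState V c i).r = 0
  conj : ∀ i < k, inner ℝ (cgState V c k).q (V (cgState V c i).q) = 0
  descent : inner ℝ (cgState V c k).r (cgState V c k).q = ‖(cgState V c k).r‖ ^ 2

include hpos in
-- If the denominator vanishes, coercivity forces q = 0, and then ⟨r, q⟩ = ‖r‖² forces r = 0, so the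
-- convention for division by zero does no harm.
lemma CGInvariant.length_mul {k : ℕ} (h : CGInvariant V c k) :
    cgLength V (cgState V c k) * inner ℝ (cgState V c k).q (V (cgState V c k).q) =
      ‖(cgState V c k).r‖ ^ 2 := by
  rw [cgLength]
  by_cases h0 : inner ℝ (cgState V c k).q (V (cgState V c k).q) = (0 : ℝ)
  · have h1 := hpos (cgState V c k).q
    rw [h0] at h1
    have h2 : (cgState V c k).q = 0 := by
      have : ‖(cgState V c k).q‖ = 0 := by nlinarith [norm_nonneg (cgState V c k).q]
      simpa using this
    have h3 := h.descent
    rw [h2] at h3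
    rw [h0, ← h3]; simp
  · field_simp

include hsymm in
-- Each residual is its search direction minus a multiple of the preceding direction, and conjugacy
-- removes the latter.
lemma CGInvariant.inner_V_q_r {k : ℕ} (h : CGInvariant V c k) :
    inner ℝ (V (cgState V c k).q) (cgState V c k).r =
      inner ℝ (cgState V c k).q (V (cgState V c k).q) ∧
    ∀ i < k, inner ℝ (V (cgState V c k).q) (cgState V c i).r = 0 := by
  have key : ∀ i ≤ k, inner ℝ (V (cgState V c k).q) (cgState V c i).r =
      inner ℝ (V (cgState V c k).q) (cgState V c i).q := by
    intro i hi
    cases i with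
    | zero => rfl
    | succ i =>
      rw [cgState_succ_q, inner_add_right, inner_smul_right, hsymm _ (cgState V c i).q,
        h.conj i (by omega)]
      simp
  refine ⟨by rw [key k le_rfl, hsymm], fun i hi => ?_⟩
  rw [key i hi.le, hsymm, h.conj i hi]

include hsymm hpos in
lemma cgInvariant (k : ℕ) : CGInvariant V c k := by
  induction k using Nat.strong_induction_on with
  | _ k ih =>
  cases k with
  | zero =>
    refine ⟨fun i hi => absurd hi (Nat.not_lt_zero i), fun i hi => absurd hi (Nat.not_lt_zero i), ?_⟩
    exact real_inner_self_eq_norm_sq _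
  | succ k =>
    have hk := ih k (Nat.lt_succ_self k)
    have hlen := hk.length_mul c hpos
    obtain ⟨hVr, hVi⟩ := hk.inner_V_q_r c hsymm
    have hres : ∀ i < k + 1, inner ℝ (cgState V c (k + 1)).r (cgState V c i).r = 0 := by
      intro i hi
      rw [cgState_succ_r, inner_sub_left, inner_smul_left]
      rcases Nat.lt_succ_iff_lt_or_eq.mp hi with hi | rfl
      · rw [hk.residual i hi, hVi i hi]; simp
      · rw [hVr, real_inner_self_eq_norm_sq]
        simp only [conj_trivial]; linarith
    refine ⟨hres, fun i hi => ?_, ?_⟩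
    · have hi' := ih i hi
      have hleni := hi'.length_mul c hpos
      -- After termination everything vanishes. Otherwise the step length is nonzero and V q_i is a
      -- multiple of a difference of residuals, so conjugacy reduces to orthogonality of residuals.
      by_cases hzero : (cgState V c i).r = 0
      · have h1 : (cgState V c (k + 1)).r = 0 := cgState_r_eq_zero_of_le V c hi.le hzero
        have h2 : cgCoeff V (cgState V c k) = 0 := by
          rw [cgCoeff, ← cgState_succ, h1]; simp
        rw [cgState_succ_q, h1, h2]; simp
      · have ha : cgLength V (cgState V c i) ≠ 0 := by
          intro h0
          rw [h0, zero_mul] at hleni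
          exact hzero (by simpa using hleni.symm)
        have hV : cgLength V (cgState V c i) • V (cgState V c i).q =
            (cgState V c i).r - (cgState V c (i + 1)).r := by
          rw [cgState_succ_r]; abel
        have h1 : cgLength V (cgState V c i) *
            inner ℝ (cgState V c (k + 1)).q (V (cgState V c i).q) = 0 := by
          rw [cgState_succ_q, inner_add_left, mul_add, inner_smul_left,
            ← inner_smul_right (cgState V c (k + 1)).r, hV, inner_sub_right, hres i hi]
          rcases Nat.lt_succ_iff_lt_or_eq.mp hi with hi | rfl
          · rw [hk.conj i hi, hres (i + 1) (by omega)]; simp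
          · have := cgCoeff_mul V c i
            rw [real_inner_self_eq_norm_sq]
            simp only [conj_trivial]
            linear_combination this + cgCoeff V (cgState V c i) * hleni
        exact (mul_eq_zero.mp h1).resolve_left ha
    · have h1 : inner ℝ (cgState V c (k + 1)).r (cgState V c k).q = 0 := by
        rw [cgState_succ_r, inner_sub_left, inner_smul_left, hk.descent, hsymm]
        simp only [conj_trivial]; linarith
      rw [cgState_succ_q, inner_add_right, inner_smul_right, h1, real_inner_self_eq_norm_sq]
      simp

include hsymm hpos in
/-- A conjugate gradient iterate is orthogonal to its residual. -/
lemma inner_cgIterate (k : ℕ) :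
    inner ℝ (cgIterate V c k) (V (cgIterate V c k)) = inner ℝ (cgIterate V c k) c := by
  have hk := cgInvariant c hsymm hpos
  change inner ℝ (cgState V c k).x (V (cgState V c k).x) = inner ℝ (cgState V c k).x c
  -- The iterate is a combination of earlier directions, all conjugate to the current one.
  have hVx : ∀ k, inner ℝ (cgState V c k).q (V (cgState V c k).x) = 0 := by
    intro k
    rw [cgState_x_eq_sum, map_sum, inner_sum]
    refine Finset.sum_eq_zero fun i hi => ?_
    rw [map_smul, inner_smul_right, (hk k).conj i (Finset.mem_range.mp hi), mul_zero]
  have hmain : inner ℝ (cgState V c k).x (cgState V c k).r = 0 := by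
    induction k with
    | zero => simp [cgState_zero]
    | succ k ih =>
      have h1 := (hk k).length_mul c hpos
      have h2 := (hk k).descent
      have h3 := hVx k
      rw [real_inner_comm] at h2
      rw [cgState_succ_r, cgState_succ_x]
      simp only [inner_sub_right, inner_add_left, inner_smul_left, inner_smul_right, conj_trivial]
      rw [ih, h2, ← hsymm (cgState V c k).x, real_inner_comm, h3]
      linear_combination -cgLength V (cgState V c k) * h1
  rw [cgState_r_eq, inner_sub_right] at hmain
  linarith

include hsymm hpos in
/-- The conjugate gradient method terminates with the exact solution. -/
lemma exists_cgIterate_eq [FiniteDimensional ℝ E] : ∃ k, V (cgIterate V c k) = c := by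
  have hk := cgInvariant c hsymm hpos
  suffices h : ∃ k, (cgState V c k).r = 0 by
    obtain ⟨k, h⟩ := h
    exact ⟨k, by rw [cgState_r_eq, sub_eq_zero] at h; exact h.symm⟩
  by_contra! hne
  -- Without termination there would be one more nonzero orthogonal residual than the dimension
  -- allows.
  have hli : LinearIndependent ℝ
      (fun k : Fin (Module.finrank ℝ E + 1) => (cgState V c k).r) := by
    refine linearIndependent_of_ne_zero_of_inner_eq_zero (fun k => hne k) fun i j hij => ?_
    rcases lt_or_gt_of_ne (fun h => hij (Fin.ext h) : (i : ℕ) ≠ j) with h | h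
    · rw [real_inner_comm]; exact (hk j).residual i h
    · exact (hk i).residual j h
  have := hli.fintype_card_le_finrank
  simp at this

end ConjugateGradient

/-! # Inexact Newton methods for strongly convex functions -/

section AbstractNewton

variable {E : Type*} [NormedAddCommGroup E] [InnerProductSpace ℝ E]

/-- The function `f` with gradient field `F` is strongly convex with modulus one and its gradient
has Lipschitz constant at most `L`. -/
structure StronglyConvexSmooth (f : E → ℝ) (F : E → E) (L : ℝ) : Prop where
  lower : ∀ x y, (1 / 2 : ℝ) * ‖y - x‖ ^ 2 ≤ f y - f x - inner ℝ (F x) (y - x)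
  upper : ∀ x y, f y - f x - inner ℝ (F x) (y - x) ≤ L / 2 * ‖y - x‖ ^ 2
  lipschitz : ∀ x y, ‖F y - F x‖ ≤ L * ‖y - x‖
  one_le : 1 ≤ L

/-- The direction `d` solves `V d = -F x` inexactly, for an operator `V` above the identity and
bounded by `K`, in such a way that the residual is orthogonal to `d`. -/
structure IsInexactNewtonDirection (F : E → E) (K η τ : ℝ) (x : E) (V : E →L[ℝ] E) (d : E) :
    Prop where
  coercive : ∀ z, ‖z‖ ^ 2 ≤ inner ℝ z (V z)
  bound : ∀ z, ‖V z‖ ≤ K * ‖z‖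
  inner_eq : inner ℝ d (V d) = -inner ℝ (F x) d
  residual_le : ‖V d + F x‖ ≤ min η (‖F x‖ ^ (1 + τ))

lemma norm_le_of_coercive {V : E →L[ℝ] E} (h : ∀ z, ‖z‖ ^ 2 ≤ inner ℝ z (V z)) (z : E) :
    ‖z‖ ≤ ‖V z‖ := by
  have h1 := (h z).trans (real_inner_le_norm _ _)
  by_contra! h2
  nlinarith [norm_nonneg z, norm_nonneg (V z)]

namespace StronglyConvexSmooth

variable {f : E → ℝ} {F : E → E} {L : ℝ}

/-- The two quadratic bounds squeeze the first order remainder between 0 and a multiple of ‖y - x‖².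
-/
lemma hasGradientAt [CompleteSpace E] (h : StronglyConvexSmooth f F L) (x : E) :
    HasGradientAt f (F x) x := by
  rw [hasGradientAt_iff_isLittleO]
  have hO : (fun y => f y - f x - inner ℝ (F x) (y - x)) =O[𝓝 x] fun y => ‖y - x‖ ^ 2 := by
    refine Asymptotics.IsBigO.of_bound (L / 2) (Eventually.of_forall fun y => ?_)
    have h1 := h.lower x y
    rw [Real.norm_of_nonneg (by nlinarith [sq_nonneg ‖y - x‖]), Real.norm_of_nonneg (by positivity)]
    exact h.upper x y
  refine hO.trans_isLittleO ?_
  have h2 : Tendsto (fun y => ‖y - x‖) (𝓝 x) (𝓝 0) := by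
    have : Continuous fun y => ‖y - x‖ := by fun_prop
    simpa using this.tendsto x
  have h3 : (fun y => ‖y - x‖ * ‖y - x‖) =o[𝓝 x] fun y => (1 : ℝ) * ‖y - x‖ :=
    ((Asymptotics.isLittleO_one_iff ℝ).mpr h2).mul_isBigO (Asymptotics.isBigO_refl _ _)
  refine Asymptotics.IsLittleO.of_norm_right ?_
  simpa [pow_two] using h3

/-- Sum of the lower bounds with the roles of x and y exchanged. -/
lemma sq_norm_le_inner (h : StronglyConvexSmooth f F L) (x y : E) :
    ‖y - x‖ ^ 2 ≤ inner ℝ (F y - F x) (y - x) := by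
  have h1 := h.lower x y
  have h2 := h.lower y x
  rw [norm_sub_rev x y, ← neg_sub y x, inner_neg_right] at h2
  rw [inner_sub_left]
  linarith

/-- A strongly convex function on a Euclidean space has a minimizer. -/
lemma exists_isMinOn [FiniteDimensional ℝ E] (h : StronglyConvexSmooth f F L) :
    ∃ x, IsMinOn f Set.univ x := by
  have hcont : Continuous f :=
    continuous_iff_continuousAt.mpr fun x => (h.hasGradientAt x).continuousAt
  have hlow : ∀ y, f 0 + ‖y‖ * (‖y‖ * (1 / 2) - ‖F 0‖) ≤ f y := by
    intro y
    have h1 := h.lower 0 y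
    have h2 := neg_le_of_abs_le (abs_real_inner_le_norm (F 0) (y - 0))
    simp only [sub_zero] at h1 h2
    nlinarith
  have hcoer : Tendsto f (cocompact E) atTop := by
    refine tendsto_atTop_mono hlow (tendsto_atTop_add_const_left _ _ ?_)
    have hn := tendsto_norm_cocompact_atTop (E := E)
    exact hn.atTop_mul_atTop₀ (tendsto_atTop_add_const_right _ _ (hn.atTop_mul_const (by norm_num)))
  obtain ⟨x, hx⟩ := hcont.exists_forall_le hcoer
  exact ⟨x, fun y _ => hx y⟩

lemma gradient_eq_zero_of_isMinOn [CompleteSpace E] (h : StronglyConvexSmooth f F L) {x : E}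
    (hx : IsMinOn f Set.univ x) : F x = 0 := by
  have h1 := (hx.isLocalMin univ_mem).hasFDerivAt_eq_zero (h.hasGradientAt x).hasFDerivAt
  simpa using h1

lemma eq_of_isMinOn [CompleteSpace E] (h : StronglyConvexSmooth f F L) {x y : E}
    (hx : IsMinOn f Set.univ x) (hy : IsMinOn f Set.univ y) : y = x := by
  have h1 := h.lower x y
  have h2 : f y ≤ f x := hy (Set.mem_univ x)
  rw [h.gradient_eq_zero_of_isMinOn hx, inner_zero_left] at h1
  have : ‖y - x‖ = 0 := by nlinarith [norm_nonneg (y - x)]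
  exact sub_eq_zero.mp (norm_eq_zero.mp this)

end StronglyConvexSmooth

/-- Splits the minimum a as a^(τ/(1+τ)) · a^(1/(1+τ)), bounding the first factor through η and the
second through t. It turns the accuracy test into a relative one, with a factor below one when η <
1. -/
lemma min_rpow_le {η τ t : ℝ} (hη : 0 < η) (hτ : 0 < τ) (ht : 0 ≤ t) :
    min η (t ^ (1 + τ)) ≤ η ^ (τ / (1 + τ)) * t := by
  have hpos : 0 < 1 + τ := by linarith
  set a := min η (t ^ (1 + τ)) with ha
  have ha0 : 0 ≤ a := le_min hη.le (Real.rpow_nonneg ht _)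
  have h1 : a = a ^ (τ / (1 + τ)) * a ^ (1 / (1 + τ)) := by
    rcases ha0.eq_or_lt with h0 | h0
    · rw [← h0, Real.zero_rpow (by positivity)]; simp
    · rw [← Real.rpow_add h0, ← add_div, add_comm τ 1, div_self hpos.ne', Real.rpow_one]
  have h2 : a ^ (1 / (1 + τ)) ≤ t := by
    refine (Real.rpow_le_rpow ha0 (min_le_right _ _) (by positivity)).trans_eq ?_
    rw [← Real.rpow_mul ht, mul_one_div_cancel hpos.ne', Real.rpow_one]
  rw [h1]
  exact mul_le_mul (Real.rpow_le_rpow ha0 (min_le_left _ _) (by positivity)) h2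
    (Real.rpow_nonneg ha0 _) (Real.rpow_nonneg hη.le _)

namespace IsInexactNewtonDirection

variable {f : E → ℝ} {F : E → E} {L K η τ : ℝ} {x d : E} {V : E →L[ℝ] E}

/-- Orthogonality of the residual makes d a descent direction without any use of the accuracy test.
-/
lemma sq_norm_le (hd : IsInexactNewtonDirection F K η τ x V d) :
    ‖d‖ ^ 2 ≤ -inner ℝ (F x) d := hd.inner_eq ▸ hd.coercive d

lemma norm_gradient_le (hd : IsInexactNewtonDirection F K η τ x V d) (hη : 0 < η) (hτ : 0 < τ) :
    (1 - η ^ (τ / (1 + τ))) * ‖F x‖ ≤ K * ‖d‖ := by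
  have h1 := hd.residual_le.trans (min_rpow_le hη hτ (norm_nonneg _))
  have h2 : ‖F x‖ ≤ ‖V d + F x‖ + ‖V d‖ := by
    simpa using norm_sub_le (V d + F x) (V d)
  linarith [hd.bound d]

/-- Sufficient decrease holds for all short steps. -/
lemma armijo_of_le (hd : IsInexactNewtonDirection F K η τ x V d)
    (h : StronglyConvexSmooth f F L) {μ t : ℝ} (ht : 0 ≤ t) (htL : t * L ≤ 2 * (1 - μ)) :
    f (x + t • d) ≤ f x + μ * t * inner ℝ (F x) d := by
  have h1 := h.upper x (x + t • d)
  rw [add_sub_cancel_left, inner_smul_right, norm_smul, Real.norm_of_nonneg ht] at h1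
  have h2 := hd.sq_norm_le
  have h3 : t * L * (t * ‖d‖ ^ 2) ≤ 2 * (1 - μ) * (t * ‖d‖ ^ 2) :=
    mul_le_mul_of_nonneg_right htL (by positivity)
  -- The first factor is just 2(1 - μ); the fact lets ‖d‖² be replaced by -⟨F x, d⟩ in the quadratic
  -- term.
  have h4 : 0 ≤ (2 * (1 - μ) - t * L + t * L) * (t * (-inner ℝ (F x) d - ‖d‖ ^ 2)) := by
    have : 0 ≤ t * L := mul_nonneg ht (by linarith [h.one_le])
    exact mul_nonneg (by linarith) (mul_nonneg ht (by linarith))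
  nlinarith

lemma exists_armijo (hd : IsInexactNewtonDirection F K η τ x V d)
    (h : StronglyConvexSmooth f F L) {μ δ : ℝ} (hμ : μ < 1) (hδ : δ ∈ Set.Ioo (0 : ℝ) 1) :
    ∃ i : ℕ, f (x + δ ^ i • d) ≤ f x + μ * δ ^ i * inner ℝ (F x) d := by
  have hL : 0 < L := by linarith [h.one_le]
  obtain ⟨i, hi⟩ := exists_pow_lt_of_lt_one (div_pos (by linarith : 0 < 2 * (1 - μ)) hL) hδ.2
  refine ⟨i, hd.armijo_of_le h (pow_nonneg hδ.1.le _) ?_⟩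
  rw [lt_div_iff₀ hL] at hi
  exact hi.le

end IsInexactNewtonDirection

/-- One step of a damped inexact Newton method with backtracking line search. -/
def IsDampedNewtonStep (f : E → ℝ) (F : E → E) (J : E → Set (E →L[ℝ] E)) (K μ η τ δ : ℝ)
    (x x' : E) : Prop :=
  ∃ V ∈ J x, ∃ d, IsInexactNewtonDirection F K η τ x V d ∧ ∃ i : ℕ,
    IsLeast {i : ℕ | f (x + δ ^ i • d) ≤ f x + μ * δ ^ i * inner ℝ (F x) d} i ∧ x' = x + δ ^ i • d

section Convergence

variable {f : E → ℝ} {F : E → E} {J : E → Set (E →L[ℝ] E)} {L K μ η τ δ : ℝ}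

/-- Every step decreases the objective by a fixed multiple of the squared gradient norm. -/
lemma IsDampedNewtonStep.exists_decrease (h : StronglyConvexSmooth f F L) (hK : 0 < K)
    (hμ : μ ∈ Set.Ioo (0 : ℝ) (1 / 2)) (hη : η ∈ Set.Ioo (0 : ℝ) 1) (hτ : 0 < τ)
    (hδ : δ ∈ Set.Ioo (0 : ℝ) 1) :
    ∃ c > 0, ∀ x x', IsDampedNewtonStep f F J K μ η τ δ x x' → f x' + c * ‖F x‖ ^ 2 ≤ f x := by
  obtain ⟨hμ0, hμ1⟩ := hμ
  have hL : 0 < L := by linarith [h.one_le]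
  have hρ : η ^ (τ / (1 + τ)) < 1 := Real.rpow_lt_one hη.1.le hη.2 (by positivity)
  set ρ := η ^ (τ / (1 + τ))
  -- Lower bound for accepted steps: either the unit step is taken, or the previous trial step was
  -- rejected and so exceeded 2(1 - μ)/L.
  set a := min 1 (δ * (2 * (1 - μ) / L))
  have ha : 0 < a := lt_min one_pos (mul_pos hδ.1 (div_pos (by linarith) hL))
  have hr : 0 < (1 - ρ) / K := div_pos (by linarith) hK
  refine ⟨μ * a * ((1 - ρ) / K) ^ 2, by positivity, ?_⟩
  rintro x x' ⟨V, -, d, hd, i, hi, rfl⟩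
  have hstep : a ≤ δ ^ i := by
    cases i with
    | zero => rw [pow_zero]; exact min_le_left _ _
    | succ i =>
      have h1 : ¬ δ ^ i * L ≤ 2 * (1 - μ) := fun hle =>
        absurd (hi.2 (hd.armijo_of_le h (pow_nonneg hδ.1.le i) hle)) (by omega)
      rw [pow_succ']
      refine (min_le_right _ _).trans (mul_le_mul_of_nonneg_left ?_ hδ.1.le)
      rw [div_le_iff₀ hL]
      exact (not_le.mp h1).le
  have h1 : f (x + δ ^ i • d) ≤ f x + μ * δ ^ i * inner ℝ (F x) d := hi.1
  have h2 := hd.sq_norm_le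
  have h3 : (1 - ρ) / K * ‖F x‖ ≤ ‖d‖ := by
    rw [div_mul_eq_mul_div, div_le_iff₀ hK]
    linarith [hd.norm_gradient_le hη.1 hτ]
  have h4 : ((1 - ρ) / K) ^ 2 * ‖F x‖ ^ 2 ≤ ‖d‖ ^ 2 := by
    rw [← mul_pow]
    exact pow_le_pow_left₀ (by positivity) h3 2
  have h5 : a * (((1 - ρ) / K) ^ 2 * ‖F x‖ ^ 2) ≤ δ ^ i * -inner ℝ (F x) d :=
    mul_le_mul hstep (h4.trans h2) (by positivity) (ha.le.trans hstep)
  nlinarith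

/-- Global convergence of the damped inexact Newton method. -/
lemma tendsto_of_isDampedNewtonStep (h : StronglyConvexSmooth f F L) (hK : 0 < K)
    (hμ : μ ∈ Set.Ioo (0 : ℝ) (1 / 2)) (hη : η ∈ Set.Ioo (0 : ℝ) 1) (hτ : 0 < τ)
    (hδ : δ ∈ Set.Ioo (0 : ℝ) 1) {xbar : E} (hmin : IsMinOn f Set.univ xbar) (hbar : F xbar = 0)
    {x : ℕ → E} (hx : ∀ j, IsDampedNewtonStep f F J K μ η τ δ (x j) (x (j + 1))) :
    Tendsto x atTop (𝓝 xbar) := by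
  obtain ⟨c, hc, hdec⟩ := IsDampedNewtonStep.exists_decrease (J := J) h hK hμ hη hτ hδ
  have hanti : Antitone fun j => f (x j) := antitone_nat_of_succ_le fun j => by
    have := hdec _ _ (hx j)
    nlinarith [mul_nonneg hc.le (sq_nonneg ‖F (x j)‖)]
  have hbdd : BddBelow (Set.range fun j => f (x j)) :=
    ⟨f xbar, by rintro _ ⟨j, rfl⟩; exact hmin (Set.mem_univ _)⟩
  have hlim := tendsto_atTop_ciInf hanti hbdd
  have hdiff : Tendsto (fun j => (f (x j) - f (x (j + 1))) / c) atTop (𝓝 0) := by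
    simpa using (hlim.sub ((tendsto_add_atTop_iff_nat 1).mpr hlim)).div_const c
  -- Strong convexity gives ‖x - xbar‖ ≤ ‖F x‖, and the decrease of `f` bounds ‖F x‖² by differences
  -- of a convergent sequence.
  have hsq : Tendsto (fun j => ‖x j - xbar‖ ^ 2) atTop (𝓝 0) := by
    refine squeeze_zero (fun j => by positivity) (fun j => ?_) hdiff
    have h1 := hdec _ _ (hx j)
    have h2 := h.sq_norm_le_inner xbar (x j)
    rw [hbar, sub_zero] at h2
    have h3 : ‖x j - xbar‖ ≤ ‖F (x j)‖ := by
      by_contra! h4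
      nlinarith [real_inner_le_norm (F (x j)) (x j - xbar), norm_nonneg (F (x j))]
    rw [le_div_iff₀ hc]
    have h4 : ‖x j - xbar‖ ^ 2 ≤ ‖F (x j)‖ ^ 2 := pow_le_pow_left₀ (norm_nonneg _) h3 2
    nlinarith
  rw [tendsto_iff_norm_sub_tendsto_zero]
  simpa using hsq.sqrt

/-- The full inexact Newton step reduces the error to its power `1 + τ`, up to a constant, if the
operators satisfy the strong semismoothness estimate. -/
lemma exists_norm_newton_step_le (h : StronglyConvexSmooth f F L) (hτ : τ ∈ Set.Ioc (0 : ℝ) 1)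
    {xbar : E} (hbar : F xbar = 0)
    (hsemi : ∃ C, ∀ᶠ x in 𝓝 xbar, ∀ V ∈ J x, ‖F x - F xbar - V (x - xbar)‖ ≤ C * ‖x - xbar‖ ^ 2) :
    ∃ C, ∀ᶠ x in 𝓝 xbar, ∀ V ∈ J x, ∀ d, IsInexactNewtonDirection F K η τ x V d →
      ‖x + d - xbar‖ ≤ C * ‖x - xbar‖ ^ (1 + τ) := by
  obtain ⟨C, hC⟩ := hsemi
  refine ⟨L ^ (1 + τ) + |C|, ?_⟩
  have hball : ∀ᶠ x in 𝓝 xbar, ‖x - xbar‖ < 1 := by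
    filter_upwards [Metric.ball_mem_nhds xbar one_pos] with x hx
    simpa [dist_eq_norm] using hx
  filter_upwards [hC, hball] with x hx hx1 V hV d hd
  have hL : 0 ≤ L := by linarith [h.one_le]
  -- Linear system residual minus linearization error; `V` does not shrink norms, so bounding these
  -- two suffices.
  have h1 : V (x + d - xbar) = (V d + F x) - (F x - F xbar - V (x - xbar)) := by
    rw [hbar, add_sub_right_comm, map_add]; abel
  have h2 : ‖V d + F x‖ ≤ L ^ (1 + τ) * ‖x - xbar‖ ^ (1 + τ) := by
    rw [← Real.mul_rpow hL (norm_nonneg _)]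
    refine (hd.residual_le.trans (min_le_right _ _)).trans
      (Real.rpow_le_rpow (norm_nonneg _) ?_ (by linarith [hτ.1]))
    simpa [hbar] using h.lipschitz xbar x
  have h3 : ‖x - xbar‖ ^ 2 ≤ ‖x - xbar‖ ^ (1 + τ) := by
    rcases (norm_nonneg (x - xbar)).eq_or_lt with h0 | h0
    · rw [← h0, Real.zero_rpow (by linarith [hτ.1])]; simp
    · rw [← Real.rpow_natCast]
      exact Real.rpow_le_rpow_of_exponent_ge h0 hx1.le (by push_cast; linarith [hτ.2])
  calc ‖x + d - xbar‖ ≤ ‖V (x + d - xbar)‖ := norm_le_of_coercive hd.coercive _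
    _ ≤ ‖V d + F x‖ + ‖F x - F xbar - V (x - xbar)‖ := by rw [h1]; exact norm_sub_le _ _
    _ ≤ L ^ (1 + τ) * ‖x - xbar‖ ^ (1 + τ) + |C| * ‖x - xbar‖ ^ (1 + τ) := by
      refine add_le_add h2 ((hx V hV).trans ?_)
      exact mul_le_mul (le_abs_self C) h3 (by positivity) (abs_nonneg C)
    _ = _ := by ring

/-- Near the minimizer the full step satisfies the Armijo condition. -/
lemma eventually_armijo_one (h : StronglyConvexSmooth f F L) (hμ : μ ∈ Set.Ioo (0 : ℝ) (1 / 2))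
    (hτ : τ ∈ Set.Ioc (0 : ℝ) 1) {xbar : E} (hbar : F xbar = 0)
    (hsemi : ∃ C, ∀ᶠ x in 𝓝 xbar, ∀ V ∈ J x, ‖F x - F xbar - V (x - xbar)‖ ≤ C * ‖x - xbar‖ ^ 2)
    (htrap : ∃ C, ∀ᶠ x in 𝓝 xbar,
      (1 / 2 : ℝ) * inner ℝ (F x + F xbar) (x - xbar) - C * ‖x - xbar‖ ^ 3 ≤ f x - f xbar) :
    ∀ᶠ x in 𝓝 xbar, ∀ V ∈ J x, ∀ d, IsInexactNewtonDirection F K η τ x V d →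
      f (x + d) ≤ f x + μ * inner ℝ (F x) d := by
  obtain ⟨hμ0, hμ1⟩ := hμ
  have hL := h.one_le
  obtain ⟨C, hC⟩ := exists_norm_newton_step_le (K := K) (η := η) h hτ hbar hsemi
  obtain ⟨D, hD⟩ := htrap
  have hcont : Tendsto (fun x => ‖x - xbar‖) (𝓝 xbar) (𝓝 0) := by
    have : Continuous fun x => ‖x - xbar‖ := by fun_prop
    simpa using this.tendsto xbar
  -- These are the error terms of the Armijo inequality divided by ‖x - xbar‖². They compete with
  -- (1/2 - μ)⟨F x, x - xbar⟩, which is at least (1/2 - μ)‖x - xbar‖².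
  have hlim : Tendsto (fun x => D * ‖x - xbar‖ + μ * L * (C * ‖x - xbar‖ ^ τ) +
      L / 2 * (C * ‖x - xbar‖ ^ τ) ^ 2) (𝓝 xbar) (𝓝 0) := by
    have h1 : Tendsto (fun x => C * ‖x - xbar‖ ^ τ) (𝓝 xbar) (𝓝 0) := by
      have := (hcont.rpow_const (p := τ) (Or.inr hτ.1.le)).const_mul C
      simpa [Real.zero_rpow hτ.1.ne'] using this
    simpa using ((hcont.const_mul D).add (h1.const_mul (μ * L))).add ((h1.pow 2).const_mul (L / 2))
  filter_upwards [hC, hD, hlim.eventually (gt_mem_nhds (by linarith : 0 < 1 / 2 - μ))]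
    with x hx hDx hsmall V hV d hd
  have hz := hx V hV d hd
  have hpow : ‖x - xbar‖ ^ (1 + τ) = ‖x - xbar‖ * ‖x - xbar‖ ^ τ := by
    rw [Real.rpow_add_of_nonneg (norm_nonneg _) zero_le_one hτ.1.le, Real.rpow_one]
  rw [hpow] at hz
  set t := ‖x - xbar‖ with ht
  set q := C * t ^ τ with hq
  have ht0 : 0 ≤ t := norm_nonneg _
  have hz' : ‖x + d - xbar‖ ≤ q * t := by rw [hq]; linarith
  have h1 := h.upper xbar (x + d)
  have h2 := h.sq_norm_le_inner xbar x
  have h3 := h.lipschitz xbar x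
  rw [hbar, inner_zero_left] at h1
  rw [hbar, sub_zero] at h2 h3
  rw [hbar, add_zero] at hDx
  have h4 : inner ℝ (F x) d = inner ℝ (F x) (x + d - xbar) - inner ℝ (F x) (x - xbar) := by
    rw [← inner_sub_right]; congr 1; abel
  have h5 : -(L * t * (q * t)) ≤ inner ℝ (F x) (x + d - xbar) := by
    refine neg_le_of_abs_le ((abs_real_inner_le_norm _ _).trans ?_)
    exact mul_le_mul h3 hz' (norm_nonneg _) (by positivity)
  have h6 : ‖x + d - xbar‖ ^ 2 ≤ (q * t) ^ 2 := pow_le_pow_left₀ (norm_nonneg _) hz' 2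
  have h7 : L / 2 * ‖x + d - xbar‖ ^ 2 ≤ L / 2 * (q * t) ^ 2 :=
    mul_le_mul_of_nonneg_left h6 (by linarith)
  have h8 := mul_le_mul_of_nonneg_left h5 hμ0.le
  have h9 := mul_le_mul_of_nonneg_left h2 (by linarith : 0 ≤ 1 / 2 - μ)
  have h10 := mul_le_mul_of_nonneg_right hsmall.le (sq_nonneg t)
  rw [h4]
  nlinarith

/-- Superlinear convergence of order `1 + τ` of the damped inexact Newton method. -/
lemma isBigO_of_isDampedNewtonStep (h : StronglyConvexSmooth f F L)
    (hμ : μ ∈ Set.Ioo (0 : ℝ) (1 / 2)) (hτ : τ ∈ Set.Ioc (0 : ℝ) 1) {xbar : E} (hbar : F xbar = 0)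
    (hsemi : ∃ C, ∀ᶠ x in 𝓝 xbar, ∀ V ∈ J x, ‖F x - F xbar - V (x - xbar)‖ ≤ C * ‖x - xbar‖ ^ 2)
    (htrap : ∃ C, ∀ᶠ x in 𝓝 xbar,
      (1 / 2 : ℝ) * inner ℝ (F x + F xbar) (x - xbar) - C * ‖x - xbar‖ ^ 3 ≤ f x - f xbar)
    {x : ℕ → E} (hx : ∀ j, IsDampedNewtonStep f F J K μ η τ δ (x j) (x (j + 1)))
    (hlim : Tendsto x atTop (𝓝 xbar)) :
    (fun j => ‖x (j + 1) - xbar‖) =O[atTop] fun j => ‖x j - xbar‖ ^ (1 + τ) := by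
  obtain ⟨C, hC⟩ := exists_norm_newton_step_le (K := K) (η := η) h hτ hbar hsemi
  have hone := eventually_armijo_one (K := K) (η := η) h hμ hτ hbar hsemi htrap
  refine Asymptotics.IsBigO.of_bound C ?_
  filter_upwards [hlim.eventually hC, hlim.eventually hone] with j hj hj1
  obtain ⟨V, hV, d, hd, i, hi, hxi⟩ := hx j
  have hi0 : i = 0 := Nat.le_zero.mp (hi.2 (by simpa using hj1 V hV d hd))
  rw [hxi, hi0, norm_norm, Real.norm_of_nonneg (Real.rpow_nonneg (norm_nonneg _) _)]
  simpa using hj V hV d hd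

end Convergence

end AbstractNewton

/-! # Proximal mappings and projections -/

section Prox

variable {E : Type*} [NormedAddCommGroup E] [InnerProductSpace ℝ E]

/-- Three-point identity behind the quadratic growth that identifies both proximal points and
projections. -/
lemma half_norm_sub_sq (u x z : E) : (1 / 2 : ℝ) * ‖z - u‖ ^ 2 + inner ℝ (u - x) (z - x) =
    (1 / 2 : ℝ) * ‖x - u‖ ^ 2 + (1 / 2 : ℝ) * ‖z - x‖ ^ 2 := by
  have h : z - u = (z - x) - (u - x) := by abel
  rw [h, norm_sub_sq_real, norm_sub_rev x u, real_inner_comm]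
  ring

/-- A point at which `u - x` is a subgradient is the proximal point of `u`. -/
lemma prox_eq_of_subgradient {h : E → EReal} {u x : E} {a : ℝ} (hx : h x = a)
    (hsub : ∀ z, ((a + inner ℝ (u - x) (z - x) : ℝ) : EReal) ≤ h z) : prox h u = x := by
  -- The extra term ‖z - x‖²/2 makes the minimizer unique, so the `Classical.epsilon` choice must be
  -- x.
  have key : ∀ z, ((a + (1 / 2 : ℝ) * ‖x - u‖ ^ 2 + (1 / 2 : ℝ) * ‖z - x‖ ^ 2 : ℝ) : EReal) ≤
      h z + (((1 / 2 : ℝ) * ‖z - u‖ ^ 2 : ℝ) : EReal) := by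
    intro z
    refine le_trans (le_of_eq ?_) (add_le_add_left (hsub z) _)
    rw [← EReal.coe_add, EReal.coe_eq_coe_iff]
    linarith [half_norm_sub_sq u x z]
  have hprox : IsProx h u x := by
    intro z
    refine le_trans ?_ (key z)
    rw [hx, ← EReal.coe_add, EReal.coe_le_coe_iff]
    nlinarith [sq_nonneg ‖z - x‖]
  have h1 : IsProx h u (prox h u) := Classical.epsilon_spec ⟨x, hprox⟩
  have h2 := (key _).trans (h1 x)
  rw [hx, ← EReal.coe_add, EReal.coe_le_coe_iff] at h2
  have h3 : ‖prox h u - x‖ = 0 := by nlinarith [norm_nonneg (prox h u - x)]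
  exact sub_eq_zero.mp (norm_eq_zero.mp h3)

lemma metricProj_eq_of_inner_le {C : Set E} {u x : E} (hx : x ∈ C)
    (h : ∀ z ∈ C, inner ℝ (u - x) (z - x) ≤ 0) : metricProj C u = x := by
  have hproj : IsProj C u x := by
    refine ⟨hx, fun z hz => ?_⟩
    have h1 := half_norm_sub_sq u x z
    have h2 := h z hz
    rw [norm_sub_rev u x, norm_sub_rev u z]
    refine le_of_sq_le_sq ?_ (norm_nonneg _)
    nlinarith [sq_nonneg ‖z - x‖]
  have h1 : IsProj C u (metricProj C u) := Classical.epsilon_spec ⟨x, hproj⟩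
  have h2 := h1.2 x hx
  have h3 := h _ h1.1
  have h4 := half_norm_sub_sq u x (metricProj C u)
  rw [norm_sub_rev u x, norm_sub_rev u] at h2
  have h5 := pow_le_pow_left₀ (norm_nonneg _) h2 2
  have h6 : ‖metricProj C u - x‖ = 0 := by nlinarith [norm_nonneg (metricProj C u - x)]
  exact sub_eq_zero.mp (norm_eq_zero.mp h6)

/-- The projection onto the closed ball of radius `r` around the origin. -/
def ballProj (r : ℝ) (v : E) : E := if ‖v‖ ≤ r then v else (r / ‖v‖) • v

/-- The factor by which `v ↦ v - ballProj r v` scales the vector `v`. -/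
def shrinkCoeff (r : ℝ) (v : E) : ℝ := if ‖v‖ ≤ r then 0 else 1 - r / ‖v‖

lemma ballProj_of_le {r : ℝ} {v : E} (h : ‖v‖ ≤ r) : ballProj r v = v := if_pos h

lemma ballProj_of_lt {r : ℝ} {v : E} (h : r < ‖v‖) : ballProj r v = (r / ‖v‖) • v :=
  if_neg (not_le.mpr h)

lemma sub_ballProj (r : ℝ) (v : E) : v - ballProj r v = shrinkCoeff r v • v := by
  unfold ballProj shrinkCoeff
  split_ifs
  · simp
  · rw [sub_smul, one_smul]

omit [InnerProductSpace ℝ E] in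
lemma shrinkCoeff_nonneg (r : ℝ) (v : E) : 0 ≤ shrinkCoeff r v := by
  unfold shrinkCoeff
  split_ifs with h
  · exact le_rfl
  · rw [sub_nonneg]
    exact div_le_one_of_le₀ (not_le.mp h).le (norm_nonneg _)

variable {r : ℝ} (hr : 0 ≤ r)
include hr

lemma norm_ballProj_le (v : E) : ‖ballProj r v‖ ≤ r := by
  unfold ballProj
  split_ifs with h
  · exact h
  · have : 0 < ‖v‖ := hr.trans_lt (not_le.mp h)
    rw [norm_smul, Real.norm_of_nonneg (by positivity), div_mul_cancel₀ _ this.ne']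

/-- Outside the ball the projection has norm r and points in the direction of the remainder, so
Cauchy–Schwarz is an equality; otherwise the remainder is zero. -/
lemma inner_ballProj_sub (v : E) :
    inner ℝ (ballProj r v) (v - ballProj r v) = r * ‖v - ballProj r v‖ := by
  rw [sub_ballProj, norm_smul, Real.norm_of_nonneg (shrinkCoeff_nonneg r v), inner_smul_right]
  unfold ballProj shrinkCoeff
  split_ifs with h
  · simp
  · have : 0 < ‖v‖ := hr.trans_lt (not_le.mp h)
    rw [inner_smul_left, real_inner_self_eq_norm_sq]
    simp only [conj_trivial]
    field_simp

lemma inner_sub_ballProj_le (v : E) {z : E} (hz : ‖z‖ ≤ r) :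
    inner ℝ (v - ballProj r v) (z - ballProj r v) ≤ 0 := by
  rw [inner_sub_right, real_inner_comm (ballProj r v), inner_ballProj_sub hr]
  have h := real_inner_le_norm (v - ballProj r v) z
  nlinarith [mul_le_mul_of_nonneg_left hz (norm_nonneg (v - ballProj r v))]

lemma metricProj_closedBall (v : E) : metricProj (Metric.closedBall 0 r) v = ballProj r v :=
  metricProj_eq_of_inner_le (by simpa using norm_ballProj_le hr v)
    fun _ hz => inner_sub_ballProj_le hr v (by simpa using hz)

/-- Firm nonexpansiveness: the variational inequalities of the two projections are added. -/
lemma sq_norm_ballProj_sub_le (v w : E) :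
    ‖ballProj r w - ballProj r v‖ ^ 2 ≤ inner ℝ (w - v) (ballProj r w - ballProj r v) := by
  have h1 := inner_sub_ballProj_le hr v (norm_ballProj_le hr w)
  have h2 := inner_sub_ballProj_le hr w (norm_ballProj_le hr v)
  rw [← real_inner_self_eq_norm_sq]
  rw [← neg_sub (ballProj r w) (ballProj r v), inner_neg_right] at h2
  have h3 : inner ℝ (w - v) (ballProj r w - ballProj r v) =
      inner ℝ (w - ballProj r w) (ballProj r w - ballProj r v)
      - inner ℝ (v - ballProj r v) (ballProj r w - ballProj r v)
      + inner ℝ (ballProj r w - ballProj r v) (ballProj r w - ballProj r v) := by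
    rw [← inner_sub_left, ← inner_add_left]; congr 1; abel
  linarith

lemma norm_ballProj_sub_le (v w : E) : ‖ballProj r w - ballProj r v‖ ≤ ‖w - v‖ := by
  have h1 := (sq_norm_ballProj_sub_le hr v w).trans (real_inner_le_norm _ _)
  by_contra! h2
  nlinarith [norm_nonneg (w - v)]

lemma norm_shrink_sub_le (v w : E) :
    ‖(w - ballProj r w) - (v - ballProj r v)‖ ≤ ‖w - v‖ := by
  have h1 := sq_norm_ballProj_sub_le hr v w
  have h2 : (w - ballProj r w) - (v - ballProj r v) =
    (w - v) - (ballProj r w - ballProj r v) := by abel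
  refine le_of_sq_le_sq ?_ (norm_nonneg _)
  rw [h2, norm_sub_sq_real]
  nlinarith [sq_nonneg ‖ballProj r w - ballProj r v‖]

end Prox

/-! # Restriction to the groups -/

section Restriction

variable {n : ℕ}

@[simp] lemma restrictTo_apply (G : Finset (Fin n)) (x : EuclideanSpace ℝ (Fin n))
    (i : {i // i ∈ G}) : restrictTo G x i = x i := rfl

lemma adjoint_restrictTo_apply (G : Finset (Fin n)) (z : EuclideanSpace ℝ {i // i ∈ G})
    (i : Fin n) : ContinuousLinearMap.adjoint (restrictTo G) z i =
      if h : i ∈ G then z ⟨i, h⟩ else 0 := by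
  have h1 : ContinuousLinearMap.adjoint (restrictTo G) z i =
      inner ℝ (EuclideanSpace.single i (1 : ℝ)) (ContinuousLinearMap.adjoint (restrictTo G) z) := by
    simp [EuclideanSpace.inner_single_left]
  rw [h1, ContinuousLinearMap.adjoint_inner_right, PiLp.inner_apply]
  simp only [restrictTo_apply, PiLp.single_apply]
  split_ifs with h
  · rw [Finset.sum_eq_single ⟨i, h⟩]
    · simp
    · rintro ⟨j, hj⟩ - hne
      have : j ≠ i := fun h => hne (Subtype.ext h)
      simp [this]
    · simp
  · refine Finset.sum_eq_zero ?_
    rintro ⟨j, hj⟩ -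
    have : j ≠ i := fun h' => h (h' ▸ hj)
    simp [this]

end Restriction

/-! ### Closed forms of the proximal mappings of `varphi`, `p` and `p*/σ` -/

namespace SGLasso

variable {m n g : ℕ} {S : SGLasso m n g}

/-- Componentwise soft thresholding. -/
def softThreshold (S : SGLasso m n g) (u : EuclideanSpace ℝ (Fin n)) : EuclideanSpace ℝ (Fin n) :=
  WithLp.toLp 2 fun i => u i - ballProj S.lam1 (u i)

@[simp] lemma softThreshold_apply (u : EuclideanSpace ℝ (Fin n)) (i : Fin n) :
    S.softThreshold u i = u i - ballProj S.lam1 (u i) := rfl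

/-- The radii of the balls that belong to the groups. -/
def radius (S : SGLasso m n g) (l : Fin g) : ℝ := S.lam2 * S.w l

/-- The closed form of the proximal mapping of `p`. -/
def sparseShrink (S : SGLasso m n g) (u : EuclideanSpace ℝ (Fin n)) : EuclideanSpace ℝ (Fin n) :=
  S.softThreshold u - ∑ l, ContinuousLinearMap.adjoint (restrictTo (S.G l))
    (ballProj (S.radius l) (restrictTo (S.G l) (S.softThreshold u)))

section Admissible

variable (hS : S.Admissible)
include hS

lemma Admissible.radius_nonneg (l : Fin g) : 0 ≤ S.radius l :=
  mul_nonneg hS.lam2_nonneg (hS.w_pos l).le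

lemma Admissible.sum_groups (f : Fin n → ℝ) : ∑ l, ∑ i : {i // i ∈ S.G l}, f i = ∑ i, f i := by
  have h : (Finset.univ : Finset (Fin n)) = Finset.univ.biUnion S.G := by
    ext i
    simpa using hS.cover i
  rw [h, Finset.sum_biUnion fun i _ j _ hij => hS.disjoint i j hij]
  exact Finset.sum_congr rfl fun l _ => Finset.sum_coe_sort (S.G l) f

lemma Admissible.sum_inner_restrictTo (x y : EuclideanSpace ℝ (Fin n)) :
    ∑ l, inner ℝ (restrictTo (S.G l) x) (restrictTo (S.G l) y) = inner ℝ x y := by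
  simp only [PiLp.inner_apply, restrictTo_apply]
  exact hS.sum_groups fun i => inner ℝ (x i) (y i)

lemma Admissible.sum_norm_restrictTo_sq (x : EuclideanSpace ℝ (Fin n)) :
    ∑ l, ‖restrictTo (S.G l) x‖ ^ 2 = ‖x‖ ^ 2 := by
  simp only [← real_inner_self_eq_norm_sq]
  exact hS.sum_inner_restrictTo x x

lemma Admissible.norm_restrictTo_le (x : EuclideanSpace ℝ (Fin n)) (l : Fin g) :
    ‖restrictTo (S.G l) x‖ ≤ ‖x‖ := by
  refine le_of_sq_le_sq ?_ (norm_nonneg _)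
  rw [← hS.sum_norm_restrictTo_sq x]
  exact Finset.single_le_sum (f := fun l => ‖restrictTo (S.G l) x‖ ^ 2)
    (fun _ _ => sq_nonneg _) (Finset.mem_univ l)

lemma Admissible.norm_adjoint_restrictTo_le (l : Fin g) (z : EuclideanSpace ℝ {i // i ∈ S.G l}) :
    ‖ContinuousLinearMap.adjoint (restrictTo (S.G l)) z‖ ≤ ‖z‖ := by
  have h : ‖restrictTo (S.G l)‖ ≤ 1 := ContinuousLinearMap.opNorm_le_bound _ zero_le_one
    fun x => by simpa using hS.norm_restrictTo_le x l
  rw [← LinearIsometryEquiv.norm_map ContinuousLinearMap.adjoint] at h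
  exact (ContinuousLinearMap.le_of_opNorm_le _ h z).trans_eq (one_mul _)

lemma Admissible.restrictTo_sum_adjoint (z : ∀ l, EuclideanSpace ℝ {i // i ∈ S.G l}) (k : Fin g) :
    restrictTo (S.G k) (∑ l, ContinuousLinearMap.adjoint (restrictTo (S.G l)) (z l)) = z k := by
  ext i
  simp only [restrictTo_apply, WithLp.ofLp_sum, Finset.sum_apply, adjoint_restrictTo_apply]
  rw [Finset.sum_eq_single k]
  · simp
  · intro l _ hl
    exact dif_neg fun h => Finset.disjoint_left.mp (hS.disjoint l k hl) h i.2
  · simp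

lemma Admissible.restrictTo_sparseShrink (u : EuclideanSpace ℝ (Fin n)) (l : Fin g) :
    restrictTo (S.G l) (S.sparseShrink u) = restrictTo (S.G l) (S.softThreshold u)
      - ballProj (S.radius l) (restrictTo (S.G l) (S.softThreshold u)) := by
  rw [sparseShrink, map_sub, hS.restrictTo_sum_adjoint]

/-- Every component of `Prox_p(u)` is a nonnegative multiple of the one of `Prox_varphi(u)`. -/
lemma Admissible.exists_sparseShrink_apply (u : EuclideanSpace ℝ (Fin n)) (i : Fin n) :
    ∃ c : ℝ, 0 ≤ c ∧ S.sparseShrink u i = c * (u i - ballProj S.lam1 (u i)) := by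
  obtain ⟨l, hl⟩ := hS.cover i
  refine ⟨_, shrinkCoeff_nonneg (S.radius l) (restrictTo (S.G l) (S.softThreshold u)), ?_⟩
  change restrictTo (S.G l) (S.sparseShrink u) ⟨i, hl⟩ = _
  rw [hS.restrictTo_sparseShrink, sub_ballProj]
  rfl

omit hS in
-- The residual of `Prox_p` splits into a coordinatewise part for the 1-norm and a groupwise part
-- for the group norms, so its pairing with x can be compared with `p` term by term.
lemma inner_sub_sparseShrink (u x : EuclideanSpace ℝ (Fin n)) :
    inner ℝ (u - S.sparseShrink u) x = ∑ i, ballProj S.lam1 (u i) * x i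
      + ∑ l, inner ℝ (ballProj (S.radius l) (restrictTo (S.G l) (S.softThreshold u)))
          (restrictTo (S.G l) x) := by
  have h : u - S.sparseShrink u = (u - S.softThreshold u) +
      ∑ l, ContinuousLinearMap.adjoint (restrictTo (S.G l))
        (ballProj (S.radius l) (restrictTo (S.G l) (S.softThreshold u))) := by
    rw [sparseShrink]; abel
  rw [h, inner_add_left, sum_inner]
  congr 1
  · rw [PiLp.inner_apply]
    refine Finset.sum_congr rfl fun i _ => ?_
    simp [mul_comm]
  · exact Finset.sum_congr rfl fun l _ => ContinuousLinearMap.adjoint_inner_left _ _ _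

lemma Admissible.inner_sub_sparseShrink_le (u x : EuclideanSpace ℝ (Fin n)) :
    inner ℝ (u - S.sparseShrink u) x ≤ S.p x := by
  rw [inner_sub_sparseShrink, p, varphi, Finset.mul_sum, Finset.mul_sum]
  refine add_le_add (Finset.sum_le_sum fun i _ => ?_) (Finset.sum_le_sum fun l _ => ?_)
  · refine (le_abs_self _).trans ?_
    rw [abs_mul]
    exact mul_le_mul_of_nonneg_right (norm_ballProj_le hS.lam1_nonneg (u i)) (abs_nonneg _)
  · rw [← mul_assoc]
    exact (real_inner_le_norm _ _).trans
      (mul_le_mul_of_nonneg_right (norm_ballProj_le (hS.radius_nonneg l) _) (norm_nonneg _))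

/-- Group shrinkage only rescales thresholded components by nonnegative factors, so the
coordinatewise projections remain aligned with them and both sums attain equality. -/
lemma Admissible.inner_sub_sparseShrink_self (u : EuclideanSpace ℝ (Fin n)) :
    inner ℝ (u - S.sparseShrink u) (S.sparseShrink u) = S.p (S.sparseShrink u) := by
  rw [inner_sub_sparseShrink, p, varphi, Finset.mul_sum, Finset.mul_sum]
  congr 1
  · refine Finset.sum_congr rfl fun i _ => ?_
    obtain ⟨c, hc, h⟩ := hS.exists_sparseShrink_apply u i
    have h1 := inner_ballProj_sub hS.lam1_nonneg (u i)
    rw [h, abs_mul, abs_of_nonneg hc]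
    have h2 : ballProj S.lam1 (u i) * (u i - ballProj S.lam1 (u i)) =
        S.lam1 * |u i - ballProj S.lam1 (u i)| := by
      simpa [mul_comm] using h1
    linear_combination c * h2
  · refine Finset.sum_congr rfl fun l _ => ?_
    rw [hS.restrictTo_sparseShrink, inner_ballProj_sub (hS.radius_nonneg l), radius, mul_assoc]

lemma Admissible.proxVarphi_eq (u : EuclideanSpace ℝ (Fin n)) :
    S.proxVarphi u = S.softThreshold u := by
  refine prox_eq_of_subgradient rfl fun z => ?_
  rw [EReal.coe_le_coe_iff, varphi, varphi, Finset.mul_sum, Finset.mul_sum, PiLp.inner_apply,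
    ← Finset.sum_add_distrib]
  refine Finset.sum_le_sum fun i _ => ?_
  have h1 := inner_ballProj_sub hS.lam1_nonneg (u i)
  have h2 := norm_ballProj_le hS.lam1_nonneg (u i)
  have h3 : ballProj S.lam1 (u i) * z i ≤ S.lam1 * |z i| := by
    refine (le_abs_self _).trans ?_
    rw [abs_mul]
    exact mul_le_mul_of_nonneg_right h2 (abs_nonneg _)
  simp only [RCLike.inner_apply, conj_trivial, Real.norm_eq_abs] at h1
  simp only [RCLike.inner_apply, conj_trivial, PiLp.sub_apply, softThreshold_apply]
  linarith

lemma Admissible.proxP_eq (u : EuclideanSpace ℝ (Fin n)) : S.proxP u = S.sparseShrink u := by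
  refine prox_eq_of_subgradient rfl fun z => ?_
  rw [EReal.coe_le_coe_iff, inner_sub_right, hS.inner_sub_sparseShrink_self]
  linarith [hS.inner_sub_sparseShrink_le u z]

lemma Admissible.conjugate_sub_sparseShrink (u : EuclideanSpace ℝ (Fin n)) :
    conjugate S.p (u - S.sparseShrink u) = 0 := by
  refine le_antisymm (iSup_le fun x => ?_) (le_iSup_of_le 0 ?_)
  · rw [← EReal.coe_zero, EReal.coe_le_coe_iff, real_inner_comm]
    linarith [hS.inner_sub_sparseShrink_le u x]
  · rw [← EReal.coe_zero, EReal.coe_le_coe_iff]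
    simp [p, varphi]

omit hS in
lemma p_smul {c : ℝ} (hc : 0 ≤ c) (x : EuclideanSpace ℝ (Fin n)) : S.p (c • x) = c * S.p x := by
  simp only [p, varphi, map_smul, norm_smul, PiLp.smul_apply, smul_eq_mul, abs_mul,
    Real.norm_eq_abs, abs_of_nonneg hc, mul_add, Finset.mul_sum]
  congr 1 <;> exact Finset.sum_congr rfl fun _ _ => by ring

lemma Admissible.proxConj_eq {σ : ℝ} (hσ : 0 < σ) (u : EuclideanSpace ℝ (Fin n)) :
    S.proxConj σ u = u - S.sparseShrink u := by
  refine prox_eq_of_subgradient (a := 0) ?_ fun z => ?_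
  · rw [hS.conjugate_sub_sparseShrink, mul_zero, EReal.coe_zero]
  -- Bounds the conjugate below by testing at σ Prox_p(u); homogeneity makes σ cancel against σ⁻¹.
  · have h1 : ((inner ℝ (σ • S.sparseShrink u) z - S.p (σ • S.sparseShrink u) : ℝ) : EReal) ≤
        conjugate S.p z := le_iSup_of_le _ le_rfl
    have h2 := mul_le_mul_of_nonneg_left h1
      (by exact_mod_cast (inv_pos.mpr hσ).le : (0 : EReal) ≤ ((σ⁻¹ : ℝ) : EReal))
    refine le_trans (le_of_eq ?_) h2
    rw [← EReal.coe_mul, EReal.coe_eq_coe_iff, p_smul hσ.le, inner_smul_left,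
      ← hS.inner_sub_sparseShrink_self, sub_sub_cancel, inner_sub_right,
      real_inner_comm (u - S.sparseShrink u) (S.sparseShrink u)]
    simp only [conj_trivial]
    field_simp
    ring

end Admissible

end SGLasso

/-! # Clarke generalized Jacobians -/

section Clarke

variable {E F : Type*} [NormedAddCommGroup E] [NormedSpace ℝ E] [NormedAddCommGroup F]
  [NormedSpace ℝ F]

/-- The Clarke Jacobian of a Lipschitz map is nonempty, by Rademacher's theorem. -/
lemma LipschitzWith.clarkeJacobian_nonempty [FiniteDimensional ℝ E] [FiniteDimensional ℝ F]
    {C : NNReal} {f : E → F} (hf : LipschitzWith C f) (x : E) : (clarkeJacobian f x).Nonempty := by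
  let _ : MeasurableSpace E := borel E
  have : BorelSpace E := ⟨rfl⟩
  have hdense : Dense {z | DifferentiableAt ℝ f z} :=
    MeasureTheory.Measure.dense_of_ae (hf.ae_differentiableAt (μ := MeasureTheory.Measure.addHaar))
  obtain ⟨u, hu, hux⟩ := mem_closure_iff_seq_limit.mp (hdense x)
  have : ProperSpace (E →L[ℝ] F) := FiniteDimensional.proper ℝ _
  obtain ⟨L, -, φ, hφ, hL⟩ := tendsto_subseq_of_bounded
    (Metric.isBounded_closedBall (x := (0 : E →L[ℝ] F)) (r := C)) (x := fun k => fderiv ℝ f (u k))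
    fun k => by simpa using norm_fderiv_le_of_lipschitz ℝ hf
  exact ⟨L, subset_convexHull ℝ _
    ⟨u ∘ φ, fun k => hu _, hux.comp hφ.tendsto_atTop, hL⟩⟩

lemma LipschitzWith.norm_le_of_mem_clarkeJacobian {C : NNReal} {f : E → F}
    (hf : LipschitzWith C f) {x : E} {L : E →L[ℝ] F} (hL : L ∈ clarkeJacobian f x) : ‖L‖ ≤ C := by
  have h : clarkeJacobian f x ⊆ Metric.closedBall 0 C := by
    refine convexHull_min ?_ (convex_closedBall _ _)
    rintro L ⟨u, -, -, hL⟩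
    refine Metric.isClosed_closedBall.mem_of_tendsto hL (Eventually.of_forall fun k => ?_)
    simpa using norm_fderiv_le_of_lipschitz ℝ hf
  simpa using h hL

end Clarke

/-! ### Derivatives and Clarke Jacobian of the projection onto a ball -/

section BallDerivative

variable {E : Type*} [NormedAddCommGroup E] [InnerProductSpace ℝ E]

/-- The rank one operator `z ↦ ⟨v, z⟩ v`. -/
def rankOne (v : E) : E →L[ℝ] E := (innerSL ℝ v).smulRight v

@[simp] lemma rankOne_apply (v z : E) : rankOne v z = inner ℝ v z • v := rfl

/-- The derivative of the projection onto a ball of radius `r` at a point outside of it. -/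
def ballDeriv (r : ℝ) (v : E) : E →L[ℝ] E :=
  (r / ‖v‖) • ContinuousLinearMap.id ℝ E - (r / ‖v‖ ^ 3) • rankOne v

variable {r : ℝ} {v : E}

lemma ballProj_of_ge (hr : 0 < r) (h : r ≤ ‖v‖) : ballProj r v = (r / ‖v‖) • v := by
  rcases h.eq_or_lt with h | h
  · rw [ballProj_of_le h.ge, ← h, div_self hr.ne', one_smul]
  · exact ballProj_of_lt h

lemma ballProj_zero_radius (v : E) : ballProj 0 v = 0 := by
  simpa using norm_ballProj_le le_rfl v

omit [InnerProductSpace ℝ E] in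
lemma eventually_norm_lt (h : ‖v‖ < r) : ∀ᶠ w in 𝓝 v, ‖w‖ < r :=
  continuous_norm.continuousAt.eventually (gt_mem_nhds h)

omit [InnerProductSpace ℝ E] in
lemma eventually_lt_norm (h : r < ‖v‖) : ∀ᶠ w in 𝓝 v, r < ‖w‖ :=
  continuous_norm.continuousAt.eventually (lt_mem_nhds h)

lemma hasFDerivAt_ballProj_of_lt (h : ‖v‖ < r) :
    HasFDerivAt (ballProj r) (ContinuousLinearMap.id ℝ E) v :=
  (hasFDerivAt_id v).congr_of_eventuallyEq
    ((eventually_norm_lt h).mono fun _ hw => ballProj_of_le hw.le)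

lemma hasFDerivAt_ballProj_of_gt (hr : 0 ≤ r) (h : r < ‖v‖) :
    HasFDerivAt (ballProj r) (ballDeriv r v) v := by
  have hv : 0 < ‖v‖ := hr.trans_lt h
  have h1 : HasFDerivAt (fun w : E => ‖w‖) ((1 / ‖v‖) • innerSL ℝ v) v := by
    have h2 := (hasStrictFDerivAt_norm_sq v).hasFDerivAt.sqrt (by positivity)
    simp only [Real.sqrt_sq (norm_nonneg _)] at h2
    convert h2 using 1
    ext w
    simp
    field_simp
  have h3 := ((hasDerivAt_inv hv.ne').comp_hasFDerivAt v h1).const_mul r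
  have h4 := h3.smul (hasFDerivAt_id v)
  refine (h4.congr_fderiv ?_).congr_of_eventuallyEq
    ((eventually_lt_norm h).mono fun _ hw => ballProj_of_lt hw)
  ext w
  simp [ballDeriv, smul_smul]
  rw [sub_eq_add_neg, ← neg_smul, ← div_eq_mul_inv]
  congr 2
  field_simp
  rw [neg_smul]

/-- Along the ray (1 + t)v the one-sided derivatives at t = 0 are v from inside and 0 from outside.
-/
lemma not_differentiableAt_ballProj (hr : 0 < r) (hv : ‖v‖ = r) :
    ¬ DifferentiableAt ℝ (ballProj r) v := by
  intro hd
  have hcurve : HasDerivAt (fun t : ℝ => ballProj r (v + t • v)) (fderiv ℝ (ballProj r) v v) 0 := by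
    have h1 : HasDerivAt (fun t : ℝ => v + t • v) v 0 := by
      simpa using ((hasDerivAt_id (0 : ℝ)).smul_const v).const_add v
    have h2 : HasFDerivAt (ballProj r) (fderiv ℝ (ballProj r) v) (v + (0 : ℝ) • v) := by
      simpa using hd.hasFDerivAt
    exact h2.comp_hasDerivAt 0 h1
  have hsmul : ∀ t : ℝ, v + t • v = (1 + t) • v := fun t => by rw [add_smul, one_smul]
  have hin : HasDerivWithinAt (fun t : ℝ => ballProj r (v + t • v)) v (Set.Icc (-1) 0) 0 := by
    have h1 : HasDerivAt (fun t : ℝ => v + t • v) v 0 := by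
      simpa using ((hasDerivAt_id (0 : ℝ)).smul_const v).const_add v
    refine h1.hasDerivWithinAt.congr_of_mem (fun t ht => ballProj_of_le ?_) (by simp)
    rw [hsmul, norm_smul, hv, Real.norm_of_nonneg (by linarith [ht.1])]
    nlinarith [ht.2]
  have hout : HasDerivWithinAt (fun t : ℝ => ballProj r (v + t • v)) 0 (Set.Icc 0 1) 0 := by
    refine (hasDerivAt_const (0 : ℝ) v).hasDerivWithinAt.congr_of_mem (fun t ht => ?_) (by simp)
    have h1 : 0 < 1 + t := by linarith [ht.1]
    have h2 : ‖v + t • v‖ = (1 + t) * r := by rw [hsmul, norm_smul, hv, Real.norm_of_nonneg h1.le]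
    rw [ballProj_of_ge hr (by rw [h2]; nlinarith [ht.1]), h2, hsmul, smul_smul]
    have : r / ((1 + t) * r) * (1 + t) = 1 := by field_simp
    rw [this, one_smul]
  have e1 := (uniqueDiffOn_Icc (by norm_num : (-1 : ℝ) < 0) 0 (by simp)).eq_deriv _
    hin hcurve.hasDerivWithinAt
  have e2 := (uniqueDiffOn_Icc (by norm_num : (0 : ℝ) < 1) 0 (by simp)).eq_deriv _
    hout hcurve.hasDerivWithinAt
  have : v = 0 := e1.trans e2.symm
  rw [this, norm_zero] at hv
  exact hr.ne hv

/-- The derivative of the projection onto a ball at points of differentiability. -/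
lemma fderiv_ballProj_cases (hr : 0 ≤ r) (hd : DifferentiableAt ℝ (ballProj r) v) :
    (r = 0 ∧ fderiv ℝ (ballProj r) v = 0) ∨
    (0 < r ∧ ‖v‖ < r ∧ fderiv ℝ (ballProj r) v = ContinuousLinearMap.id ℝ E) ∨
    (0 < r ∧ r < ‖v‖ ∧ fderiv ℝ (ballProj r) v = ballDeriv r v) := by
  rcases hr.eq_or_lt with rfl | hr0
  · left
    have : (ballProj 0 : E → E) = fun _ => 0 := funext ballProj_zero_radius
    simp [this]
  · right
    rcases lt_trichotomy ‖v‖ r with h | h | h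
    · exact Or.inl ⟨hr0, h, (hasFDerivAt_ballProj_of_lt h).fderiv⟩
    · exact absurd hd (not_differentiableAt_ballProj hr0 h)
    · exact Or.inr ⟨hr0, h, (hasFDerivAt_ballProj_of_gt hr h).fderiv⟩

lemma continuousAt_ballDeriv (hv : v ≠ 0) : ContinuousAt (ballDeriv r) v := by
  have h1 : Continuous (rankOne : E → E →L[ℝ] E) := by
    have : (rankOne : E → E →L[ℝ] E) = fun v =>
        ContinuousLinearMap.smulRightL ℝ E E (innerSL ℝ v) v := by ext; rfl
    rw [this]
    fun_prop
  have h0 : ‖v‖ ≠ 0 := norm_ne_zero_iff.mpr hv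
  unfold ballDeriv
  refine ContinuousAt.sub (ContinuousAt.fun_smul ?_ continuousAt_const)
    (ContinuousAt.fun_smul ?_ h1.continuousAt)
  · exact continuousAt_const.div continuous_norm.continuousAt h0
  · exact continuousAt_const.div (continuous_norm.pow 3).continuousAt (pow_ne_zero 3 h0)

/-- Elements of the Clarke Jacobian of the projection onto a ball have the form
`I - α I - β v vᵀ`. -/
structure IsBallJacobian (r : ℝ) (v : E) (α β : ℝ) (L : E →L[ℝ] E) : Prop where
  eq : L = ContinuousLinearMap.id ℝ E - (α • ContinuousLinearMap.id ℝ E + β • rankOne v)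
  α_nonneg : 0 ≤ α
  β_nonneg : 0 ≤ β
  β_le : β * ‖v‖ ^ 2 ≤ 1
  of_lt : ‖v‖ < r → α = 0 ∧ β = 0
  of_eq : ‖v‖ = r → 0 < r → α = 0
  of_gt : 0 < r → r < ‖v‖ → L = ballDeriv r v
  of_zero : r = 0 → L = 0

lemma isBallJacobian_ballDeriv (hr : 0 < r) (h : r < ‖v‖) :
    IsBallJacobian r v (1 - r / ‖v‖) (r / ‖v‖ ^ 3) (ballDeriv r v) := by
  have hv : 0 < ‖v‖ := hr.trans h
  refine ⟨?_, sub_nonneg.mpr (div_le_one_of_le₀ h.le hv.le), by positivity, ?_, ?_, ?_, ?_, ?_⟩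
  · rw [ballDeriv, sub_smul, one_smul]; abel
  · have : r / ‖v‖ ^ 3 * ‖v‖ ^ 2 = r / ‖v‖ := by field_simp
    rw [this]
    exact div_le_one_of_le₀ h.le hv.le
  · exact fun h' => absurd h' (by linarith)
  · exact fun h' => absurd h' (by linarith)
  · exact fun _ _ => rfl
  · exact fun h' => absurd h' hr.ne'

/-- Off the sphere the derivative is locally continuous, so the Clarke Jacobian is a singleton. On
the sphere it lies in the segment from the identity to `ballDeriv r v`. -/
lemma exists_isBallJacobian (hr : 0 ≤ r) {L : E →L[ℝ] E}
    (hL : L ∈ clarkeJacobian (ballProj r) v) : ∃ α β, IsBallJacobian r v α β L := by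
  rcases hr.eq_or_lt with rfl | hr0
  · have h0 : L = 0 := by
      have hsub : clarkeJacobian (ballProj 0) v ⊆ {(0 : E →L[ℝ] E)} := by
        refine convexHull_min ?_ (convex_singleton _)
        rintro L ⟨u, hu, -, hL⟩
        have : (ballProj 0 : E → E) = fun _ => 0 := funext ballProj_zero_radius
        simp only [this, fderiv_fun_const] at hL
        exact tendsto_nhds_unique hL tendsto_const_nhds
      exact hsub hL
    refine ⟨1, 0, ?_, zero_le_one, le_rfl, by simp, ?_, ?_, ?_, fun _ => h0⟩
    · simp [h0]
    · exact fun h => absurd h (not_lt.mpr (norm_nonneg v))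
    · exact fun _ h => absurd h (lt_irrefl _)
    · exact fun h => absurd h (lt_irrefl _)
  rcases lt_trichotomy ‖v‖ r with h | h | h
  · have h0 : L = ContinuousLinearMap.id ℝ E := by
      have hsub : clarkeJacobian (ballProj r) v ⊆ {ContinuousLinearMap.id ℝ E} := by
        refine convexHull_min ?_ (convex_singleton _)
        rintro L ⟨u, hu, hux, hL⟩
        refine tendsto_nhds_unique hL (tendsto_const_nhds.congr' ?_)
        filter_upwards [hux.eventually (eventually_norm_lt h)] with k hk
        exact (hasFDerivAt_ballProj_of_lt hk).fderiv.symm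
      exact hsub hL
    refine ⟨0, 0, by simp [h0], le_rfl, le_rfl, by simp, fun _ => ⟨rfl, rfl⟩, fun _ _ => rfl, ?_, ?_⟩
    · exact fun _ h' => absurd h' (by linarith)
    · exact fun h' => absurd h' hr0.ne'
  · have hv : v ≠ 0 := by
      rintro rfl
      rw [norm_zero] at h
      exact hr0.ne h
    have hsub : clarkeJacobian (ballProj r) v ⊆
        segment ℝ (ContinuousLinearMap.id ℝ E) (ballDeriv r v) := by
      rw [← convexHull_pair]
      refine convexHull_mono ?_
      rintro L ⟨u, hu, hux, hL⟩
      by_cases hfreq : ∃ᶠ k in atTop, fderiv ℝ (ballProj r) (u k) = ballDeriv r (u k)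
      · right
        exact tendsto_nhds_unique_of_frequently_eq hL
          ((continuousAt_ballDeriv hv).tendsto.comp hux) hfreq
      · left
        refine tendsto_nhds_unique hL (tendsto_const_nhds.congr' ?_)
        filter_upwards [not_frequently.mp hfreq] with k hk
        rcases fderiv_ballProj_cases hr (hu k) with h1 | h1 | h1
        · exact absurd h1.1 hr0.ne'
        · exact h1.2.2.symm
        · exact absurd h1.2.2 hk
    obtain ⟨a, b, ha, hb, hab, rfl⟩ := hsub hL
    -- On the sphere r/‖v‖ = 1, so `ballDeriv r v` differs from the identity only in its rank one
    -- part, here weighted by b ≤ 1.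
    refine ⟨0, b * (r / ‖v‖ ^ 3), ?_, le_rfl, by positivity, ?_, ?_, fun _ _ => rfl, ?_, ?_⟩
    · rw [ballDeriv, h, div_self hr0.ne', one_smul, eq_sub_of_add_eq hab]
      module
    · have : b * (r / r ^ 3) * r ^ 2 = b := by field_simp
      rw [h, this]
      linarith
    · exact fun h' => absurd h' (by linarith)
    · exact fun _ h' => absurd h' (by linarith)
    · exact fun h' => absurd h' hr0.ne'
  · have hv : v ≠ 0 := norm_pos_iff.mp (hr0.trans h)
    have h0 : L = ballDeriv r v := by
      have hsub : clarkeJacobian (ballProj r) v ⊆ {ballDeriv r v} := by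
        refine convexHull_min ?_ (convex_singleton _)
        rintro L ⟨u, hu, hux, hL⟩
        refine tendsto_nhds_unique hL
          (((continuousAt_ballDeriv hv).tendsto.comp hux).congr' ?_)
        filter_upwards [hux.eventually (eventually_lt_norm h)] with k hk
        exact (hasFDerivAt_ballProj_of_gt hr hk).fderiv.symm
      exact hsub hL
    exact ⟨_, _, h0 ▸ isBallJacobian_ballDeriv hr0 h⟩

/-! # Second order expansions of the projection onto a ball -/

/-- Polar coordinates of a point that is not in the interior of the ball. -/
lemma exists_polar (hr : 0 < r) (h : r ≤ ‖v‖) :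
    ∃ e : E, ‖e‖ = 1 ∧ v = ‖v‖ • e ∧ ballProj r v = r • e := by
  have hv : 0 < ‖v‖ := hr.trans_le h
  refine ⟨‖v‖⁻¹ • v, ?_, ?_, ?_⟩
  · rw [norm_smul, norm_inv, norm_norm, inv_mul_cancel₀ hv.ne']
  · rw [smul_smul, mul_inv_cancel₀ hv.ne', one_smul]
  · rw [ballProj_of_ge hr h, smul_smul, div_eq_mul_inv]

lemma one_sub_inner_of_norm_one {e e' : E} (he : ‖e‖ = 1) (he' : ‖e'‖ = 1) :
    1 - inner ℝ e' e = ‖e' - e‖ ^ 2 / 2 := by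
  rw [norm_sub_sq_real, he, he']; ring

/-- With v = a e and w = ρ e' for unit vectors e, e', the error is (r/ρ)((ρ - a)(e' - e) + (a‖e' -
e‖²/2) e'). It is of second order since |ρ - a| ≤ ‖w - v‖ and r‖e' - e‖ ≤ ‖w - v‖. -/
lemma norm_ballProj_sub_ballDeriv_le {w : E} (hr : 0 < r) (hv : r ≤ ‖v‖) (hw : r < ‖w‖) :
    ‖ballProj r w - ballProj r v - ballDeriv r w (w - v)‖ ≤
      (1 / r + ‖v‖ / (2 * r ^ 2)) * ‖w - v‖ ^ 2 := by
  obtain ⟨e, he, hve, hpe⟩ := exists_polar hr hv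
  obtain ⟨e', he', hwe, hpe'⟩ := exists_polar hr hw.le
  have hlip := norm_ballProj_sub_le hr.le v w
  rw [hpe, hpe', ← smul_sub, norm_smul, Real.norm_of_nonneg hr.le] at hlip
  have hnorm := abs_norm_sub_norm_le w v
  have hρ : 0 < ‖w‖ := hr.trans hw
  have hinner := one_sub_inner_of_norm_one he he'
  have hdev : ballDeriv r w (w - v) = (r / ‖w‖) • ((w - v) - inner ℝ e' (w - v) • e') := by
    rw [ballDeriv]
    simp only [sub_apply, smul_apply, ContinuousLinearMap.id_apply, rankOne_apply]
    rw [smul_sub (r / ‖w‖) (w - v)]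
    congr 1
    conv_lhs => rw [show inner ℝ w (w - v) • w = (inner ℝ (‖w‖ • e') (w - v)) • (‖w‖ • e') by
      rw [← hwe]]
    rw [inner_smul_left, smul_smul, smul_smul, smul_smul]
    congr 1
    simp only [conj_trivial]
    field_simp
  set a := ‖v‖
  set ρ := ‖w‖
  set h := ‖w - v‖
  have hin : inner ℝ e' (w - v) = ρ - a * inner ℝ e' e := by
    rw [inner_sub_right]
    nth_rewrite 1 [hwe]
    nth_rewrite 1 [hve]
    rw [inner_smul_right, inner_smul_right, real_inner_self_eq_norm_sq, he']
    ring
  have hid : ballProj r w - ballProj r v - ballDeriv r w (w - v) =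
      (r / ρ) • ((ρ - a) • (e' - e) + (a * (‖e' - e‖ ^ 2 / 2)) • e') := by
    rw [hdev, hin, hpe, hpe', ← hinner]
    have h1 : w - v = ρ • e' - a • e := by rw [← hwe, ← hve]
    have h2 : r = r / ρ * ρ := by field_simp
    rw [h1]
    nth_rewrite 1 [h2]
    nth_rewrite 2 [h2]
    rw [mul_smul, mul_smul, ← smul_sub, ← smul_sub]
    congr 1
    module
  have hee : ‖e' - e‖ ≤ h / r := by rw [le_div_iff₀ hr]; linarith
  have hrρ : r / ρ ≤ 1 := div_le_one_of_le₀ hw.le hρ.le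
  have ha0 : 0 ≤ a := norm_nonneg _
  have hh0 : 0 ≤ h := norm_nonneg _
  have hsq : ‖e' - e‖ ^ 2 ≤ (h / r) ^ 2 := pow_le_pow_left₀ (norm_nonneg _) hee 2
  rw [hid, norm_smul, Real.norm_of_nonneg (by positivity)]
  calc r / ρ * ‖(ρ - a) • (e' - e) + (a * (‖e' - e‖ ^ 2 / 2)) • e'‖
      ≤ 1 * (h * (h / r) + a * ((h / r) ^ 2 / 2)) := by
        refine mul_le_mul hrρ ((norm_add_le _ _).trans (add_le_add ?_ ?_)) (norm_nonneg _) zero_le_one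
        · rw [norm_smul]
          exact mul_le_mul hnorm hee (norm_nonneg _) hh0
        · rw [norm_smul, he', mul_one, Real.norm_of_nonneg (by positivity)]
          gcongr
    _ = _ := by field_simp

/-- The projection onto a ball is strongly semismooth. -/
lemma ballProj_semismooth (hr : 0 ≤ r) (v : E) : ∃ C, 0 ≤ C ∧ ∀ᶠ w in 𝓝 v,
    ∀ L ∈ clarkeJacobian (ballProj r) w,
      ‖ballProj r w - ballProj r v - L (w - v)‖ ≤ C * ‖w - v‖ ^ 2 := by
  rcases hr.eq_or_lt with rfl | hr0
  · refine ⟨0, le_rfl, Eventually.of_forall fun w L hL => ?_⟩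
    obtain ⟨α, β, h⟩ := exists_isBallJacobian le_rfl hL
    simp [h.of_zero rfl, ballProj_zero_radius]
  have hin : ∀ w, ‖w‖ < r → ‖v‖ ≤ r → ∀ L ∈ clarkeJacobian (ballProj r) w,
      ‖ballProj r w - ballProj r v - L (w - v)‖ = 0 := by
    intro w hw hv L hL
    obtain ⟨α, β, h⟩ := exists_isBallJacobian hr hL
    obtain ⟨rfl, rfl⟩ := h.of_lt hw
    simp [h.eq, ballProj_of_le hw.le, ballProj_of_le hv]
  refine ⟨1 / r + ‖v‖ / (2 * r ^ 2), by positivity, ?_⟩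
  rcases lt_or_ge ‖v‖ r with hv | hv
  · filter_upwards [eventually_norm_lt hv] with w hw L hL
    rw [hin w hw hv.le L hL]
    positivity
  have hev : ∀ᶠ w in 𝓝 v, r < ‖v‖ → r < ‖w‖ := by
    by_cases h : r < ‖v‖
    · exact (eventually_lt_norm h).mono fun _ hw _ => hw
    · exact Eventually.of_forall fun _ h' => absurd h' h
  filter_upwards [hev] with w hw L hL
  obtain ⟨α, β, h⟩ := exists_isBallJacobian hr hL
  rcases lt_trichotomy ‖w‖ r with hwr | hwr | hwr
  · have hv' : ‖v‖ ≤ r := not_lt.mp fun h' => absurd (hw h') (by linarith)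
    rw [hin w hwr hv' L hL]
    positivity
  · have hv' : ‖v‖ = r := le_antisymm (not_lt.mp fun h' => absurd (hw h') (by linarith)) hv
    -- Both points lie on the sphere, so w - v is tangential up to second order, and the rank one
    -- part, undetermined there, contributes only a quadratic error.
    have hinner : inner ℝ w (w - v) = ‖w - v‖ ^ 2 / 2 := by
      rw [norm_sub_sq_real, inner_sub_right, real_inner_self_eq_norm_sq, hwr, hv']; ring
    have hα := h.of_eq hwr hr0
    have hβ : β * r ≤ 1 / r := by
      rw [le_div_iff₀ hr0]
      have := h.β_le
      rw [hwr] at this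
      linarith
    have hid : ballProj r w - ballProj r v - L (w - v) = (β * (‖w - v‖ ^ 2 / 2)) • w := by
      rw [h.eq, hα, ballProj_of_le hwr.le, ballProj_of_le hv'.le]
      simp [hinner, mul_smul]
    rw [hid, norm_smul, hwr, Real.norm_of_nonneg (mul_nonneg h.β_nonneg (by positivity))]
    have h1 : 0 ≤ ‖v‖ / (2 * r ^ 2) * ‖w - v‖ ^ 2 := by positivity
    have h2 := mul_le_mul_of_nonneg_right hβ (sq_nonneg ‖w - v‖)
    have h3 : 0 ≤ β * r * ‖w - v‖ ^ 2 := mul_nonneg (mul_nonneg h.β_nonneg hr) (sq_nonneg _)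
    linarith
  · rw [h.of_gt hr0 hwr]
    exact norm_ballProj_sub_ballDeriv_le hr0 hv hwr

/-- The projection onto a ball satisfies the trapezoidal rule up to terms of third order. -/
lemma ballProj_trapezoid (hr : 0 ≤ r) (v : E) : ∃ C, 0 ≤ C ∧ ∀ᶠ w in 𝓝 v,
    inner ℝ ((v - ballProj r v) + (w - ballProj r w)) (ballProj r w - ballProj r v) ≤
      C * ‖w - v‖ ^ 3 := by
  rcases hr.eq_or_lt with rfl | hr0
  · exact ⟨0, le_rfl, Eventually.of_forall fun w => by simp [ballProj_zero_radius]⟩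
  refine ⟨1 / (2 * r), by positivity, ?_⟩
  have hin : ∀ w, ‖w‖ ≤ r → ‖v‖ ≤ r →
      inner ℝ ((v - ballProj r v) + (w - ballProj r w)) (ballProj r w - ballProj r v) ≤
      1 / (2 * r) * ‖w - v‖ ^ 3 := by
    intro w hw hv
    rw [ballProj_of_le hw, ballProj_of_le hv]
    simp only [sub_self, add_zero, inner_zero_left]
    positivity
  rcases lt_or_ge ‖v‖ r with hv | hv
  · exact (eventually_norm_lt hv).mono fun w hw => hin w hw.le hv.le
  have hev : ∀ᶠ w in 𝓝 v, r < ‖v‖ → r < ‖w‖ := by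
    by_cases h : r < ‖v‖
    · exact (eventually_lt_norm h).mono fun _ hw _ => hw
    · exact Eventually.of_forall fun _ h' => absurd h' h
  filter_upwards [hev] with w hw
  rcases le_or_gt ‖w‖ r with hwr | hwr
  · exact hin w hwr (not_lt.mp fun h' => absurd (hw h') (by linarith))
  obtain ⟨e, he, hve, hpe⟩ := exists_polar hr0 hv
  obtain ⟨e', he', hwe, hpe'⟩ := exists_polar hr0 hwr.le
  have hlip := norm_ballProj_sub_le hr v w
  rw [hpe, hpe', ← smul_sub, norm_smul, Real.norm_of_nonneg hr] at hlip
  have hnorm := (le_abs_self _).trans (abs_norm_sub_norm_le w v)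
  have hinner := one_sub_inner_of_norm_one he he'
  -- In polar coordinates the radial change contributes one order and the angular change two.
  have hid : inner ℝ ((v - ballProj r v) + (w - ballProj r w)) (ballProj r w - ballProj r v) =
      (‖w‖ - ‖v‖) * (r * (‖e' - e‖ ^ 2 / 2)) := by
    have h1 : v - ballProj r v = (‖v‖ - r) • e := by rw [hpe, sub_smul, ← hve]
    have h2 : w - ballProj r w = (‖w‖ - r) • e' := by rw [hpe', sub_smul, ← hwe]
    rw [h1, h2, hpe, hpe', ← smul_sub, inner_smul_right, inner_add_left, inner_smul_left,
      inner_smul_left, inner_sub_right, inner_sub_right, real_inner_self_eq_norm_sq,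
      real_inner_self_eq_norm_sq, real_inner_comm e' e, he, he', ← hinner]
    simp only [conj_trivial]
    ring
  rw [hid]
  have hsq : (r * ‖e' - e‖) ^ 2 ≤ ‖w - v‖ ^ 2 := pow_le_pow_left₀ (by positivity) hlip 2
  calc (‖w‖ - ‖v‖) * (r * (‖e' - e‖ ^ 2 / 2))
      ≤ ‖w - v‖ * (r * (‖e' - e‖ ^ 2 / 2)) := mul_le_mul_of_nonneg_right hnorm (by positivity)
    _ = ‖w - v‖ * ((r * ‖e' - e‖) ^ 2 / (2 * r)) := by field_simp
    _ ≤ ‖w - v‖ * (‖w - v‖ ^ 2 / (2 * r)) := by gcongr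
    _ = _ := by ring

end BallDerivative

/-! # Soft thresholding -/

section Scalar

variable {r : ℝ}

lemma ballProj_eq_of_mul_pos {s t : ℝ} (hr : 0 < r) (hs : r ≤ |s|) (ht : r ≤ |t|)
    (hst : 0 < s * t) : ballProj r s = ballProj r t := by
  have hs0 : 0 < |s| := hr.trans_le hs
  have ht0 : 0 < |t| := hr.trans_le ht
  rw [ballProj_of_ge hr hs, ballProj_of_ge hr ht]
  simp only [Real.norm_eq_abs, smul_eq_mul]
  rcases mul_pos_iff.mp hst with ⟨h1, h2⟩ | ⟨h1, h2⟩
  · rw [abs_of_pos h1, abs_of_pos h2, div_mul_cancel₀ _ h1.ne', div_mul_cancel₀ _ h2.ne']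
  · rw [abs_of_neg h1, abs_of_neg h2, div_neg, div_neg, neg_mul, neg_mul,
      div_mul_cancel₀ _ h1.ne, div_mul_cancel₀ _ h2.ne]

/-- Close to `t`, either `t` and `s` have the same projection onto `[-r, r]`, or both belong to
this interval. -/
lemma eventually_ballProj_real (hr : 0 < r) (t : ℝ) : ∀ᶠ s in 𝓝 t,
    (r ≤ |s| ∧ r ≤ |t| ∧ ballProj r s = ballProj r t ∧ (|s| = r → s = t)) ∨
      (|s| < r ∧ |t| ≤ r) := by
  rcases lt_or_ge |t| r with ht | ht
  · filter_upwards [eventually_norm_lt (v := t) ht] with s hs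
    exact Or.inr ⟨hs, ht.le⟩
  have ht0 : t ≠ 0 := abs_pos.mp (hr.trans_le ht)
  have h1 : ∀ᶠ s in 𝓝 t, 0 < s * t := by
    have hc : ContinuousAt (fun s => s * t) t := by fun_prop
    exact hc.eventually (lt_mem_nhds (mul_self_pos.mpr ht0))
  have h2 : ∀ᶠ s in 𝓝 t, r < |t| → r < |s| := by
    by_cases h : r < |t|
    · exact (eventually_lt_norm (v := t) h).mono fun _ hs _ => hs
    · exact Eventually.of_forall fun _ h' => absurd h' h
  filter_upwards [h1, h2] with s hst hs
  rcases lt_or_ge |s| r with hsr | hsr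
  · exact Or.inr ⟨hsr, not_lt.mp fun h => absurd (hs h) (not_lt.mpr hsr.le)⟩
  · refine Or.inl ⟨hsr, ht, ballProj_eq_of_mul_pos hr hsr ht hst, fun hsr' => ?_⟩
    have htr : |t| = r := le_antisymm (not_lt.mp fun h => (hs h).ne' hsr') ht
    rcases abs_eq_abs.mp (hsr'.trans htr.symm) with h | h
    · exact h
    · rw [h] at hst
      nlinarith [mul_self_nonneg t]

/-- `θ` is an element of the Clarke Jacobian of the soft thresholding of a real number. -/
structure IsThresholdSlope (r t θ : ℝ) : Prop where
  nonneg : 0 ≤ θ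
  le_one : θ ≤ 1
  of_lt : |t| < r → θ = 0
  of_gt : r < |t| → θ = 1
  of_zero : r = 0 → θ = 1

/-- Near t the projection either stays constant or fixes both points. The slope is ambiguous only
for |s| = r > 0, and then the first alternative gives s = t. The two product identities are the
scalar trapezoidal rule with no error. -/
lemma eventually_ballProj_sub (hr : 0 ≤ r) (t : ℝ) : ∀ᶠ s in 𝓝 t,
    (∀ θ, IsThresholdSlope r s θ → θ * (s - t) = (s - ballProj r s) - (t - ballProj r t)) ∧
    (t - ballProj r t) * (ballProj r s - ballProj r t) = 0 ∧
    (s - ballProj r s) * (ballProj r s - ballProj r t) = 0 := by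
  rcases hr.eq_or_lt with rfl | hr0
  · refine Eventually.of_forall fun s => ⟨fun θ hθ => ?_, ?_, ?_⟩
    · simp [hθ.of_zero rfl, ballProj_zero_radius]
    all_goals simp [ballProj_zero_radius]
  filter_upwards [eventually_ballProj_real hr0 t] with s hs
  rcases hs with ⟨hs, ht, heq, hst⟩ | ⟨hs, ht⟩
  · refine ⟨fun θ hθ => ?_, by rw [heq]; ring, by rw [heq]; ring⟩
    rcases hs.eq_or_lt with h | h
    · rw [hst h.symm]; ring
    · rw [hθ.of_gt h, heq]; ring
  · have h1 : ballProj r s = s := ballProj_of_le hs.le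
    have h2 : ballProj r t = t := ballProj_of_le ht
    refine ⟨fun θ hθ => ?_, ?_, ?_⟩
    · rw [hθ.of_lt hs, h1, h2]; ring
    all_goals rw [h1, h2]; ring

/-- The projection onto [-r, r] has derivative 1 - d, and only the three cases of
`fderiv_ballProj_cases` can occur; in one dimension `ballDeriv` is zero. -/
lemma isThresholdSlope_of_hasDerivAt (hr : 0 ≤ r) {t d : ℝ}
    (hd : HasDerivAt (fun s => s - ballProj r s) d t) : IsThresholdSlope r t d := by
  have h1 : HasDerivAt (ballProj r) (1 - d) t :=
    ((hasDerivAt_id t).sub hd).congr_of_eventuallyEq (Eventually.of_forall fun s => by simp)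
  have h2 : fderiv ℝ (ballProj r) t 1 = 1 - d := by
    rw [fderiv_apply_one_eq_deriv, h1.deriv]
  have h3 : ∀ x y : ℝ, |x| < y → ¬ y < |x| := fun x y h => not_lt.mpr h.le
  rcases fderiv_ballProj_cases hr h1.differentiableAt with ⟨h0, h⟩ | ⟨h0, ht, h⟩ | ⟨h0, ht, h⟩
  · rw [h] at h2
    have hd1 : d = 1 := by simp at h2; linarith
    refine ⟨by linarith, by linarith, fun h => ?_, fun _ => hd1, fun _ => hd1⟩
    exact absurd h (not_lt.mpr (h0 ▸ abs_nonneg t))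
  · rw [h] at h2
    have hd0 : d = 0 := by simp at h2; linarith
    exact ⟨by linarith, by linarith, fun _ => hd0, fun h => absurd h (h3 _ _ ht),
      fun h => absurd h h0.ne'⟩
  · rw [h] at h2
    have ht0 : 0 < |t| := h0.trans ht
    have hd1 : d = 1 := by
      simp only [ballDeriv, sub_apply, smul_apply, ContinuousLinearMap.id_apply, rankOne_apply,
        Real.norm_eq_abs, smul_eq_mul, RCLike.inner_apply, conj_trivial, one_mul, mul_one] at h2
      rw [← pow_two, ← sq_abs] at h2
      field_simp at h2
      have h4 : |t| * (1 - d) = 0 := by linarith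
      linarith [(mul_eq_zero.mp h4).resolve_left ht0.ne']
    exact ⟨by linarith, by linarith, fun h => absurd ht (h3 _ _ h), fun _ => hd1,
      fun h => absurd h h0.ne'⟩

end Scalar

/-! ### Clarke Jacobian and semismoothness of soft thresholding -/

namespace SGLasso

variable {m n g : ℕ} {S : SGLasso m n g}

/-- `L` is a diagonal operator whose entries belong to the Clarke Jacobians of the components of
the soft thresholding at `u`. -/
def IsThresholdJacobian (S : SGLasso m n g) (u : EuclideanSpace ℝ (Fin n))
    (L : EuclideanSpace ℝ (Fin n) →L[ℝ] EuclideanSpace ℝ (Fin n)) : Prop :=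
  ∀ i, IsThresholdSlope S.lam1 (u i) (L (EuclideanSpace.single i 1) i) ∧
    ∀ x, L x i = L (EuclideanSpace.single i 1) i * x i

lemma convex_isThresholdJacobian (u : EuclideanSpace ℝ (Fin n)) :
    Convex ℝ {L | S.IsThresholdJacobian u L} := by
  intro L hL L' hL' a b ha hb hab i
  obtain ⟨h, h1⟩ := hL i
  obtain ⟨h', h1'⟩ := hL' i
  simp only [add_apply, smul_apply, PiLp.add_apply, PiLp.smul_apply, smul_eq_mul]
  refine ⟨⟨?_, ?_, fun hu => ?_, fun hu => ?_, fun hu => ?_⟩, fun x => ?_⟩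
  · have := h.nonneg
    have := h'.nonneg
    positivity
  · nlinarith [h.le_one, h'.le_one]
  · rw [h.of_lt hu, h'.of_lt hu]; simp
  · rw [h.of_gt hu, h'.of_gt hu]; simpa using hab
  · rw [h.of_zero hu, h'.of_zero hu]; simpa using hab
  · rw [h1, h1']; ring

section Admissible

variable (hS : S.Admissible)
include hS

/-- Component i depends on coordinate i alone: restricting to the line through u along that axis
gives the slope, and the chain rule back shows that the operator is diagonal. -/
lemma Admissible.isThresholdJacobian_of_hasFDerivAt {u : EuclideanSpace ℝ (Fin n)}
    {L : EuclideanSpace ℝ (Fin n) →L[ℝ] EuclideanSpace ℝ (Fin n)}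
    (hL : HasFDerivAt S.softThreshold L u) : S.IsThresholdJacobian u L := by
  intro i
  have hLi : HasFDerivAt (fun w => S.softThreshold w i) ((EuclideanSpace.proj i).comp L) u :=
    (EuclideanSpace.proj (𝕜 := ℝ) i).hasFDerivAt.comp u hL
  have hd : HasDerivAt (fun s => s - ballProj S.lam1 s) (L (EuclideanSpace.single i 1) i) (u i) := by
    have h1 : HasDerivAt (fun s : ℝ => u + (s - u i) • EuclideanSpace.single i (1 : ℝ))
        (EuclideanSpace.single i (1 : ℝ)) (u i) := by
      simpa using (((hasDerivAt_id (u i)).sub_const (u i)).smul_const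
        (EuclideanSpace.single i (1 : ℝ))).const_add u
    have h2 : HasFDerivAt (fun w => S.softThreshold w i) ((EuclideanSpace.proj i).comp L)
        (u + (u i - u i) • EuclideanSpace.single i (1 : ℝ)) := by simpa using hLi
    have h3 := h2.comp_hasDerivAt (u i) h1
    refine h3.congr_of_eventuallyEq (Eventually.of_forall fun s => ?_)
    simp
  refine ⟨isThresholdSlope_of_hasDerivAt hS.lam1_nonneg hd, fun x => ?_⟩
  have h4 := hd.comp_hasFDerivAt u (EuclideanSpace.proj (𝕜 := ℝ) i).hasFDerivAt
  have h5 := DFunLike.congr_fun (hLi.unique h4) x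
  simpa using h5

/-- The conditions are convex and pass to limits, because |u i| < r and |u i| > r are open
conditions. -/
lemma Admissible.isThresholdJacobian_of_mem {u : EuclideanSpace ℝ (Fin n)}
    {L : EuclideanSpace ℝ (Fin n) →L[ℝ] EuclideanSpace ℝ (Fin n)}
    (hL : L ∈ clarkeJacobian S.softThreshold u) : S.IsThresholdJacobian u L := by
  refine convexHull_min ?_ (convex_isThresholdJacobian u) hL
  rintro L ⟨v, hv, hvu, hlim⟩ i
  have hk : ∀ k, S.IsThresholdJacobian (v k) (fderiv ℝ S.softThreshold (v k)) := fun k =>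
    hS.isThresholdJacobian_of_hasFDerivAt (hv k).hasFDerivAt
  have hev : ∀ x, Tendsto (fun k => fderiv ℝ S.softThreshold (v k) x i) atTop (𝓝 (L x i)) := by
    intro x
    have hc : Continuous fun T : EuclideanSpace ℝ (Fin n) →L[ℝ] EuclideanSpace ℝ (Fin n) =>
        T x i := by fun_prop
    exact (hc.tendsto L).comp hlim
  have hvi : Tendsto (fun k => v k i) atTop (𝓝 (u i)) := by
    have hc : Continuous fun w : EuclideanSpace ℝ (Fin n) => w i := by fun_prop
    exact (hc.tendsto u).comp hvu
  refine ⟨⟨?_, ?_, fun hu => ?_, fun hu => ?_, fun hu => ?_⟩, fun x => ?_⟩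
  · exact ge_of_tendsto' (hev _) fun k => (hk k i).1.nonneg
  · exact le_of_tendsto' (hev _) fun k => (hk k i).1.le_one
  · refine tendsto_nhds_unique (hev _) (tendsto_const_nhds.congr' ?_)
    filter_upwards [hvi.eventually (eventually_norm_lt hu)] with k h
    exact ((hk k i).1.of_lt h).symm
  · refine tendsto_nhds_unique (hev _) (tendsto_const_nhds.congr' ?_)
    filter_upwards [hvi.eventually (eventually_lt_norm hu)] with k h
    exact ((hk k i).1.of_gt h).symm
  · refine tendsto_nhds_unique (hev _) (tendsto_const_nhds.congr fun k => ?_)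
    exact ((hk k i).1.of_zero hu).symm
  · refine tendsto_nhds_unique (hev x) (((hev _).mul_const (x i)).congr fun k => ?_)
    exact ((hk k i).2 x).symm

lemma Admissible.norm_softThreshold_sub_le (u w : EuclideanSpace ℝ (Fin n)) :
    ‖S.softThreshold w - S.softThreshold u‖ ≤ ‖w - u‖ := by
  refine le_of_sq_le_sq ?_ (norm_nonneg _)
  rw [EuclideanSpace.norm_sq_eq, EuclideanSpace.norm_sq_eq]
  refine Finset.sum_le_sum fun i _ => pow_le_pow_left₀ (norm_nonneg _) ?_ 2
  exact norm_shrink_sub_le hS.lam1_nonneg (u i) (w i)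

lemma Admissible.lipschitzWith_softThreshold : LipschitzWith 1 S.softThreshold :=
  LipschitzWith.of_dist_le_mul fun u w => by
    simpa [dist_eq_norm] using hS.norm_softThreshold_sub_le w u

lemma Admissible.lipschitzWith_ballProj (l : Fin g) :
    LipschitzWith 1 (ballProj (S.radius l) : EuclideanSpace ℝ {i // i ∈ S.G l} → _) :=
  LipschitzWith.of_dist_le_mul fun u w => by
    simpa [dist_eq_norm] using norm_ballProj_sub_le (hS.radius_nonneg l) w u

/-- Soft thresholding is piecewise linear. -/
lemma Admissible.softThreshold_semismooth (u : EuclideanSpace ℝ (Fin n)) : ∀ᶠ w in 𝓝 u,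
    ∀ L ∈ clarkeJacobian S.softThreshold w,
      L (w - u) = S.softThreshold w - S.softThreshold u := by
  have hev : ∀ᶠ w in 𝓝 u, ∀ i, ∀ θ, IsThresholdSlope S.lam1 (w i) θ → θ * (w i - u i) =
      (w i - ballProj S.lam1 (w i)) - (u i - ballProj S.lam1 (u i)) := by
    refine eventually_all.mpr fun i => ?_
    have hc : Continuous fun w : EuclideanSpace ℝ (Fin n) => w i := by fun_prop
    exact ((hc.tendsto u).eventually (eventually_ballProj_sub hS.lam1_nonneg (u i))).mono
      fun w hw => hw.1
  filter_upwards [hev] with w hw L hL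
  ext i
  obtain ⟨h1, h2⟩ := hS.isThresholdJacobian_of_mem hL i
  rw [h2]
  exact hw i _ h1

/-! # The surrogate Jacobian of `Prox_p` -/

lemma Admissible.mem_surrogateJacobian {u : EuclideanSpace ℝ (Fin n)}
    {M : EuclideanSpace ℝ (Fin n) →L[ℝ] EuclideanSpace ℝ (Fin n)} :
    M ∈ S.surrogateJacobian u ↔
      ∃ (Sig : ∀ l, EuclideanSpace ℝ {i // i ∈ S.G l} →L[ℝ] EuclideanSpace ℝ {i // i ∈ S.G l})
        (Th : EuclideanSpace ℝ (Fin n) →L[ℝ] EuclideanSpace ℝ (Fin n)),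
        (∀ l, Sig l ∈ clarkeJacobian (ballProj (S.radius l))
          (restrictTo (S.G l) (S.softThreshold u))) ∧
        Th ∈ clarkeJacobian S.softThreshold u ∧
        M = (ContinuousLinearMap.id ℝ _ - ∑ l,
          (ContinuousLinearMap.adjoint (restrictTo (S.G l))) ∘L
            (Sig l) ∘L (restrictTo (S.G l))) ∘L Th := by
  have h1 : S.proxVarphi = S.softThreshold := funext hS.proxVarphi_eq
  have h2 : ∀ l, S.projBall l = ballProj (S.radius l) := fun l =>
    funext (metricProj_closedBall (hS.radius_nonneg l))
  simp only [surrogateJacobian, h1, h2]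
  rfl

lemma Admissible.surrogateJacobian_nonempty (u : EuclideanSpace ℝ (Fin n)) :
    (S.surrogateJacobian u).Nonempty := by
  choose Sig hSig using fun l => (hS.lipschitzWith_ballProj l).clarkeJacobian_nonempty
    (restrictTo (S.G l) (S.softThreshold u))
  obtain ⟨Th, hTh⟩ := hS.lipschitzWith_softThreshold.clarkeJacobian_nonempty u
  exact ⟨_, hS.mem_surrogateJacobian.mpr ⟨Sig, Th, hSig, hTh, rfl⟩⟩

/-- A crude constant suffices: only a bound uniform in the point and in `M` is needed. -/
lemma Admissible.norm_surrogate_le {u : EuclideanSpace ℝ (Fin n)}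
    {M : EuclideanSpace ℝ (Fin n) →L[ℝ] EuclideanSpace ℝ (Fin n)}
    (hM : M ∈ S.surrogateJacobian u) (x : EuclideanSpace ℝ (Fin n)) : ‖M x‖ ≤ (1 + g) * ‖x‖ := by
  obtain ⟨Sig, Th, hSig, hTh, rfl⟩ := hS.mem_surrogateJacobian.mp hM
  have hT : ‖Th x‖ ≤ ‖x‖ := by
    simpa using Th.le_of_opNorm_le
      (hS.lipschitzWith_softThreshold.norm_le_of_mem_clarkeJacobian hTh) x
  have hl : ∀ l, ‖ContinuousLinearMap.adjoint (restrictTo (S.G l))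
      (Sig l (restrictTo (S.G l) (Th x)))‖ ≤ ‖x‖ := by
    intro l
    have h1 := (Sig l).le_of_opNorm_le
      ((hS.lipschitzWith_ballProj l).norm_le_of_mem_clarkeJacobian (hSig l))
      (restrictTo (S.G l) (Th x))
    rw [NNReal.coe_one, one_mul] at h1
    exact (hS.norm_adjoint_restrictTo_le l _).trans
      (h1.trans ((hS.norm_restrictTo_le _ l).trans hT))
  simp only [ContinuousLinearMap.comp_apply, sub_apply, ContinuousLinearMap.id_apply,
    sum_apply]
  calc _ ≤ ‖Th x‖ + ∑ l, ‖ContinuousLinearMap.adjoint (restrictTo (S.G l))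
        (Sig l (restrictTo (S.G l) (Th x)))‖ :=
        (norm_sub_le _ _).trans (add_le_add_right (norm_sum_le _ _) _)
    _ ≤ ‖x‖ + ∑ _l : Fin g, ‖x‖ := add_le_add hT (Finset.sum_le_sum fun l _ => hl l)
    _ = _ := by simp; ring

/-- The bilinear form of an element of the surrogate Jacobian. -/
lemma Admissible.exists_inner_surrogate {u : EuclideanSpace ℝ (Fin n)}
    {M : EuclideanSpace ℝ (Fin n) →L[ℝ] EuclideanSpace ℝ (Fin n)}
    (hM : M ∈ S.surrogateJacobian u) :
    ∃ (θ : Fin n → ℝ) (α β : Fin g → ℝ) (v : EuclideanSpace ℝ (Fin n)),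
      (∀ i, 0 ≤ θ i) ∧ (∀ l, 0 ≤ α l) ∧ (∀ l, 0 ≤ β l) ∧ ∀ x y, inner ℝ (M x) y =
        ∑ l, (α l * ∑ i : {i // i ∈ S.G l}, θ i * (x i * y i) +
          β l * (inner ℝ (restrictTo (S.G l) v) (restrictTo (S.G l) x) *
            inner ℝ (restrictTo (S.G l) v) (restrictTo (S.G l) y))) := by
  obtain ⟨Sig, Th, hSig, hTh, rfl⟩ := hS.mem_surrogateJacobian.mp hM
  have hT := hS.isThresholdJacobian_of_mem hTh
  choose α β hB using fun l => exists_isBallJacobian (hS.radius_nonneg l) (hSig l)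
  refine ⟨fun i => Th (EuclideanSpace.single i 1) i, α, β, S.softThreshold u,
    fun i => (hT i).1.nonneg, fun l => (hB l).α_nonneg, fun l => (hB l).β_nonneg, fun x y => ?_⟩
  -- The entry of Θ can differ from 1 only where |u i| ≤ lam1, and there the thresholded vector is
  -- zero. Hence Θ does not affect the pairing with that vector, which is what makes the product
  -- with Θ symmetric.
  have hv : ∀ l, inner ℝ (restrictTo (S.G l) (S.softThreshold u)) (restrictTo (S.G l) (Th x)) =
      inner ℝ (restrictTo (S.G l) (S.softThreshold u)) (restrictTo (S.G l) x) := by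
    intro l
    simp only [PiLp.inner_apply, restrictTo_apply]
    refine Finset.sum_congr rfl fun i _ => ?_
    rcases le_or_gt |u i| S.lam1 with h | h
    · have : S.softThreshold u i = 0 := by
        rw [softThreshold_apply, ballProj_of_le (by simpa using h), sub_self]
      rw [this]; simp
    · rw [(hT i).2 x, (hT i).1.of_gt h, one_mul]
  simp only [ContinuousLinearMap.comp_apply, sub_apply, ContinuousLinearMap.id_apply,
    sum_apply]
  rw [inner_sub_left, sum_inner, ← hS.sum_inner_restrictTo (Th x) y, ← Finset.sum_sub_distrib]
  refine Finset.sum_congr rfl fun l _ => ?_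
  rw [ContinuousLinearMap.adjoint_inner_left, (hB l).eq]
  simp only [sub_apply, add_apply, smul_apply, ContinuousLinearMap.id_apply, rankOne_apply]
  rw [hv l, inner_sub_left, sub_sub_cancel, inner_add_left, inner_smul_left, inner_smul_left,
    inner_smul_left]
  simp only [conj_trivial]
  congr 2
  simp only [PiLp.inner_apply, restrictTo_apply]
  refine Finset.sum_congr rfl fun i _ => ?_
  rw [(hT i).2 x]
  simp only [RCLike.inner_apply, conj_trivial]
  ring

lemma Admissible.inner_surrogate_comm {u : EuclideanSpace ℝ (Fin n)}
    {M : EuclideanSpace ℝ (Fin n) →L[ℝ] EuclideanSpace ℝ (Fin n)}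
    (hM : M ∈ S.surrogateJacobian u) (x y : EuclideanSpace ℝ (Fin n)) :
    inner ℝ (M x) y = inner ℝ x (M y) := by
  obtain ⟨θ, α, β, v, -, -, -, h⟩ := hS.exists_inner_surrogate hM
  rw [h, real_inner_comm, h]
  refine Finset.sum_congr rfl fun l _ => ?_
  congr 2
  · exact Finset.sum_congr rfl fun i _ => by ring
  · ring

lemma Admissible.inner_surrogate_nonneg {u : EuclideanSpace ℝ (Fin n)}
    {M : EuclideanSpace ℝ (Fin n) →L[ℝ] EuclideanSpace ℝ (Fin n)}
    (hM : M ∈ S.surrogateJacobian u) (x : EuclideanSpace ℝ (Fin n)) : 0 ≤ inner ℝ x (M x) := by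
  obtain ⟨θ, α, β, v, hθ, hα, hβ, h⟩ := hS.exists_inner_surrogate hM
  rw [real_inner_comm, h]
  exact Finset.sum_nonneg fun l _ => add_nonneg
    (mul_nonneg (hα l) (Finset.sum_nonneg fun i _ => mul_nonneg (hθ i) (mul_self_nonneg _)))
    (mul_nonneg (hβ l) (mul_self_nonneg _))

/-- The mapping `Prox_p` is strongly semismooth with respect to the surrogate Jacobian. -/
lemma Admissible.sparseShrink_semismooth (u : EuclideanSpace ℝ (Fin n)) :
    ∃ C, 0 ≤ C ∧ ∀ᶠ w in 𝓝 u, ∀ M ∈ S.surrogateJacobian w,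
      ‖S.sparseShrink w - S.sparseShrink u - M (w - u)‖ ≤ C * ‖w - u‖ ^ 2 := by
  choose C hC0 hC using fun l => ballProj_semismooth (hS.radius_nonneg l)
    (restrictTo (S.G l) (S.softThreshold u))
  refine ⟨∑ l, C l, Finset.sum_nonneg fun l _ => hC0 l, ?_⟩
  have hcont : ∀ l, Continuous fun w => restrictTo (S.G l) (S.softThreshold w) := fun l =>
    (restrictTo (S.G l)).continuous.comp hS.lipschitzWith_softThreshold.continuous
  filter_upwards [eventually_all.mpr fun l => ((hcont l).tendsto u).eventually (hC l),
    hS.softThreshold_semismooth u] with w hw hTw M hM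
  obtain ⟨Sig, Th, hSig, hTh, rfl⟩ := hS.mem_surrogateJacobian.mp hM
  -- Θ reproduces the increment of soft thresholding exactly, so only the linearization errors of
  -- the ball projections remain.
  have hid : S.sparseShrink w - S.sparseShrink u -
      ((ContinuousLinearMap.id ℝ _ - ∑ l, (ContinuousLinearMap.adjoint (restrictTo (S.G l))) ∘L
        (Sig l) ∘L (restrictTo (S.G l))) ∘L Th) (w - u) =
      -∑ l, ContinuousLinearMap.adjoint (restrictTo (S.G l))
        (ballProj (S.radius l) (restrictTo (S.G l) (S.softThreshold w)) -
          ballProj (S.radius l) (restrictTo (S.G l) (S.softThreshold u)) -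
          Sig l (restrictTo (S.G l) (S.softThreshold w) -
            restrictTo (S.G l) (S.softThreshold u))) := by
    rw [ContinuousLinearMap.comp_apply, hTw Th hTh]
    simp only [ContinuousLinearMap.comp_apply, sub_apply, ContinuousLinearMap.id_apply,
      sum_apply, sparseShrink, map_sub, Finset.sum_sub_distrib]
    abel
  rw [hid, norm_neg, Finset.sum_mul]
  refine (norm_sum_le _ _).trans (Finset.sum_le_sum fun l _ => ?_)
  refine (hS.norm_adjoint_restrictTo_le l _).trans ((hw l (Sig l) (hSig l)).trans ?_)
  refine mul_le_mul_of_nonneg_left (pow_le_pow_left₀ (norm_nonneg _) ?_ 2) (hC0 l)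
  rw [← map_sub]
  exact (hS.norm_restrictTo_le _ l).trans (hS.norm_softThreshold_sub_le u w)

/-- The trapezoidal rule for the gradient `Prox_p` of the Moreau envelope. -/
lemma Admissible.sparseShrink_trapezoid (u : EuclideanSpace ℝ (Fin n)) :
    ∃ C, 0 ≤ C ∧ ∀ᶠ w in 𝓝 u,
      inner ℝ ((w - S.sparseShrink w) - (u - S.sparseShrink u))
        (S.sparseShrink u + S.sparseShrink w) ≤ C * ‖w - u‖ ^ 3 := by
  choose C hC0 hC using fun l => ballProj_trapezoid (hS.radius_nonneg l)
    (restrictTo (S.G l) (S.softThreshold u))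
  refine ⟨∑ l, C l, Finset.sum_nonneg fun l _ => hC0 l, ?_⟩
  have hcont : ∀ l, Continuous fun w => restrictTo (S.G l) (S.softThreshold w) := fun l =>
    (restrictTo (S.G l)).continuous.comp hS.lipschitzWith_softThreshold.continuous
  have hev : ∀ᶠ w in 𝓝 u, ∀ i,
      (u i - ballProj S.lam1 (u i)) * (ballProj S.lam1 (w i) - ballProj S.lam1 (u i)) = 0 ∧
      (w i - ballProj S.lam1 (w i)) * (ballProj S.lam1 (w i) - ballProj S.lam1 (u i)) = 0 := by
    refine eventually_all.mpr fun i => ?_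
    have hc : Continuous fun w : EuclideanSpace ℝ (Fin n) => w i := by fun_prop
    exact ((hc.tendsto u).eventually (eventually_ballProj_sub hS.lam1_nonneg (u i))).mono
      fun w hw => hw.2
  filter_upwards [eventually_all.mpr fun l => ((hcont l).tendsto u).eventually (hC l), hev]
    with w hw hi
  rw [inner_sub_left, inner_sub_sparseShrink, inner_sub_sparseShrink, add_sub_add_comm,
    ← Finset.sum_sub_distrib, ← Finset.sum_sub_distrib, Finset.sum_mul]
  -- The coordinatewise part vanishes by the exact scalar rule, since the components of `Prox_p` are
  -- multiples of the thresholded ones.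
  have hzero : ∑ i, (ballProj S.lam1 (w i) * (S.sparseShrink u + S.sparseShrink w) i -
      ballProj S.lam1 (u i) * (S.sparseShrink u + S.sparseShrink w) i) = 0 := by
    refine Finset.sum_eq_zero fun i _ => ?_
    obtain ⟨c, -, hc⟩ := hS.exists_sparseShrink_apply u i
    obtain ⟨c', -, hc'⟩ := hS.exists_sparseShrink_apply w i
    rw [PiLp.add_apply, hc, hc']
    linear_combination c * (hi i).1 + c' * (hi i).2
  rw [hzero, zero_add]
  refine Finset.sum_le_sum fun l _ => ?_
  rw [← inner_sub_left, map_add, hS.restrictTo_sparseShrink, hS.restrictTo_sparseShrink,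
    real_inner_comm]
  refine (hw l).trans (mul_le_mul_of_nonneg_left (pow_le_pow_left₀ (norm_nonneg _) ?_ 3) (hC0 l))
  rw [← map_sub]
  exact (hS.norm_restrictTo_le _ l).trans (hS.norm_softThreshold_sub_le u w)

end Admissible

end SGLasso

/-! # The objective of the subproblem -/

namespace SGLasso

variable {m n g : ℕ} {S : SGLasso m n g}

/-- The gradient of the objective of the subproblem. -/
def psiGradient (S : SGLasso m n g) (σ : ℝ) (xt : EuclideanSpace ℝ (Fin n))
    (y : EuclideanSpace ℝ (Fin m)) : EuclideanSpace ℝ (Fin m) :=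
  S.b + y - σ • S.A (S.sparseShrink (S.shifted σ xt y))

lemma shifted_sub (σ : ℝ) (xt : EuclideanSpace ℝ (Fin n)) (y z : EuclideanSpace ℝ (Fin m)) :
    S.shifted σ xt z - S.shifted σ xt y = -ContinuousLinearMap.adjoint S.A (z - y) := by
  simp only [shifted, map_sub]; abel

lemma norm_adjoint_le (y : EuclideanSpace ℝ (Fin m)) :
    ‖ContinuousLinearMap.adjoint S.A y‖ ≤ ‖S.A‖ * ‖y‖ := by
  have h := ContinuousLinearMap.le_opNorm (ContinuousLinearMap.adjoint S.A) y
  rwa [LinearIsometryEquiv.norm_map] at h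

lemma norm_shifted_sub_le (σ : ℝ) (xt : EuclideanSpace ℝ (Fin n))
    (y z : EuclideanSpace ℝ (Fin m)) :
    ‖S.shifted σ xt z - S.shifted σ xt y‖ ≤ ‖S.A‖ * ‖z - y‖ := by
  rw [shifted_sub, norm_neg]
  exact norm_adjoint_le _

lemma continuous_shifted (σ : ℝ) (xt : EuclideanSpace ℝ (Fin n)) :
    Continuous (S.shifted σ xt) := by
  unfold shifted
  fun_prop

section Admissible

variable (hS : S.Admissible)
include hS

/-- Among all residuals z - Prox_p(z), the one with z = u maximizes the pairing with Prox_p(u),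
reaching the bound `p`. -/
lemma Admissible.inner_sparseShrink_sub_le (u w : EuclideanSpace ℝ (Fin n)) :
    inner ℝ (S.sparseShrink u) ((w - S.sparseShrink w) - (u - S.sparseShrink u)) ≤ 0 := by
  have h1 := hS.inner_sub_sparseShrink_self u
  have h2 := hS.inner_sub_sparseShrink_le w (S.sparseShrink u)
  rw [real_inner_comm, inner_sub_left]
  linarith

lemma Admissible.norm_sparseShrink_sub_le (u w : EuclideanSpace ℝ (Fin n)) :
    ‖S.sparseShrink w - S.sparseShrink u‖ ≤ ‖w - u‖ := by
  have h1 := hS.inner_sparseShrink_sub_le u w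
  have h2 := hS.inner_sparseShrink_sub_le w u
  have h3 : ‖S.sparseShrink w - S.sparseShrink u‖ ^ 2 ≤
      inner ℝ (S.sparseShrink w - S.sparseShrink u) (w - u) := by
    rw [← real_inner_self_eq_norm_sq]
    simp only [inner_sub_left, inner_sub_right] at h1 h2 ⊢
    linarith
  have h4 := h3.trans (real_inner_le_norm _ _)
  by_contra! h5
  nlinarith [norm_nonneg (w - u)]

/-- `Prox_p` is the gradient of half its squared norm. -/
lemma Admissible.half_sq_norm_sparseShrink (u w : EuclideanSpace ℝ (Fin n)) :
    0 ≤ (1 / 2 : ℝ) * ‖S.sparseShrink w‖ ^ 2 - (1 / 2 : ℝ) * ‖S.sparseShrink u‖ ^ 2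
        - inner ℝ (S.sparseShrink u) (w - u) ∧
    (1 / 2 : ℝ) * ‖S.sparseShrink w‖ ^ 2 - (1 / 2 : ℝ) * ‖S.sparseShrink u‖ ^ 2
        - inner ℝ (S.sparseShrink u) (w - u) ≤ (1 / 2 : ℝ) * ‖w - u‖ ^ 2 := by
  have h1 := hS.inner_sparseShrink_sub_le u w
  have h2 := hS.inner_sparseShrink_sub_le w u
  set P := S.sparseShrink u
  set P' := S.sparseShrink w
  -- With D = (w - P') - (u - P), the middle expression equals both ‖P' - P‖²/2 - ⟨P, D⟩ and ‖w -
  -- u‖²/2 - ‖D‖²/2 - ⟨P', D⟩, where ⟨P, D⟩ ≤ 0 ≤ ⟨P', D⟩.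
  have h3 := sq_nonneg ‖P' - P‖
  have h4 := sq_nonneg ‖(w - u) - (P' - P)‖
  simp only [← real_inner_self_eq_norm_sq, inner_sub_left, inner_sub_right] at *
  rw [real_inner_comm P P'] at *
  rw [real_inner_comm P w, real_inner_comm P u, real_inner_comm P' w, real_inner_comm P' u,
    real_inner_comm u w] at *
  constructor <;> linarith

lemma Admissible.psiE_eq {σ : ℝ} (hσ : 0 < σ) (xt : EuclideanSpace ℝ (Fin n))
    (y : EuclideanSpace ℝ (Fin m)) : S.psiE σ xt y =
      ((inner ℝ S.b y + (1 / 2 : ℝ) * ‖y‖ ^ 2 +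
        σ / 2 * ‖S.sparseShrink (S.shifted σ xt y)‖ ^ 2 : ℝ) : EReal) := by
  rw [psiE, hS.proxConj_eq hσ, hS.conjugate_sub_sparseShrink, hS.proxP_eq, add_zero,
    ← EReal.coe_add]

lemma Admissible.psi_eq {σ : ℝ} (hσ : 0 < σ) (xt : EuclideanSpace ℝ (Fin n))
    (y : EuclideanSpace ℝ (Fin m)) : S.psi σ xt y =
      inner ℝ S.b y + (1 / 2 : ℝ) * ‖y‖ ^ 2 +
        σ / 2 * ‖S.sparseShrink (S.shifted σ xt y)‖ ^ 2 := by
  rw [psi, hS.psiE_eq hσ, EReal.toReal_coe]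

/-- The modulus one comes from ‖y‖²/2; the remaining term adds a convex part whose curvature is at
most σ‖A‖². -/
lemma Admissible.stronglyConvexSmooth_psi {σ : ℝ} (hσ : 0 < σ) (xt : EuclideanSpace ℝ (Fin n)) :
    StronglyConvexSmooth (S.psi σ xt) (S.psiGradient σ xt) (1 + σ * ‖S.A‖ ^ 2) := by
  have hexp : ∀ y z, S.psi σ xt z - S.psi σ xt y - inner ℝ (S.psiGradient σ xt y) (z - y) =
      (1 / 2 : ℝ) * ‖z - y‖ ^ 2 + σ * ((1 / 2 : ℝ) * ‖S.sparseShrink (S.shifted σ xt z)‖ ^ 2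
        - (1 / 2 : ℝ) * ‖S.sparseShrink (S.shifted σ xt y)‖ ^ 2
        - inner ℝ (S.sparseShrink (S.shifted σ xt y)) (S.shifted σ xt z - S.shifted σ xt y)) := by
    intro y z
    rw [hS.psi_eq hσ, hS.psi_eq hσ, psiGradient, shifted_sub, inner_neg_right,
      ContinuousLinearMap.adjoint_inner_right, norm_sub_sq_real, inner_sub_left, inner_add_left,
      inner_smul_left, inner_sub_right S.b, inner_sub_right y, real_inner_self_eq_norm_sq,
      real_inner_comm y z]
    simp only [conj_trivial]
    ring
  refine ⟨fun y z => ?_, fun y z => ?_, fun y z => ?_, ?_⟩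
  · rw [hexp]
    have := mul_nonneg hσ.le
      (hS.half_sq_norm_sparseShrink (S.shifted σ xt y) (S.shifted σ xt z)).1
    linarith
  · rw [hexp]
    have h1 := mul_le_mul_of_nonneg_left
      (hS.half_sq_norm_sparseShrink (S.shifted σ xt y) (S.shifted σ xt z)).2 hσ.le
    have h2 := pow_le_pow_left₀ (norm_nonneg _) (S.norm_shifted_sub_le σ xt y z) 2
    rw [mul_pow] at h2
    have h3 := mul_le_mul_of_nonneg_left h2 hσ.le
    linarith
  · have hid : S.psiGradient σ xt z - S.psiGradient σ xt y = (z - y) - σ • S.A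
        (S.sparseShrink (S.shifted σ xt z) - S.sparseShrink (S.shifted σ xt y)) := by
      simp only [psiGradient, map_sub, smul_sub]; abel
    have h1 := (hS.norm_sparseShrink_sub_le (S.shifted σ xt y) (S.shifted σ xt z)).trans
      (S.norm_shifted_sub_le σ xt y z)
    have h2 := (S.A.le_opNorm _).trans (mul_le_mul_of_nonneg_left h1 (norm_nonneg S.A))
    have h3 := mul_le_mul_of_nonneg_left h2 hσ.le
    rw [hid]
    refine (norm_sub_le _ _).trans ?_
    rw [norm_smul, Real.norm_of_nonneg hσ.le]
    linarith
  · have : 0 ≤ σ * ‖S.A‖ ^ 2 := by positivity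
    linarith

lemma Admissible.gradient_psi {σ : ℝ} (hσ : 0 < σ) (xt : EuclideanSpace ℝ (Fin n))
    (y : EuclideanSpace ℝ (Fin m)) : gradient (S.psi σ xt) y = S.psiGradient σ xt y :=
  ((hS.stronglyConvexSmooth_psi hσ xt).hasGradientAt y).gradient

/-- The trapezoidal rule is exact for the quadratic part, so the defect is σ/2 times that of
`Prox_p`. -/
lemma Admissible.psi_trapezoid {σ : ℝ} (hσ : 0 < σ) (xt : EuclideanSpace ℝ (Fin n))
    (y : EuclideanSpace ℝ (Fin m)) : ∃ C, ∀ᶠ z in 𝓝 y,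
      (1 / 2 : ℝ) * inner ℝ (S.psiGradient σ xt z + S.psiGradient σ xt y) (z - y)
        - C * ‖z - y‖ ^ 3 ≤ S.psi σ xt z - S.psi σ xt y := by
  obtain ⟨C, hC0, hC⟩ := hS.sparseShrink_trapezoid (S.shifted σ xt y)
  refine ⟨σ / 2 * (C * ‖S.A‖ ^ 3), ?_⟩
  filter_upwards [((continuous_shifted σ xt).tendsto y).eventually hC] with z hz
  have h1 := pow_le_pow_left₀ (norm_nonneg _) (S.norm_shifted_sub_le σ xt y z) 3
  rw [mul_pow] at h1
  have h2 := hz.trans (mul_le_mul_of_nonneg_left h1 hC0)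
  have hid : S.psi σ xt z - S.psi σ xt y -
      (1 / 2 : ℝ) * inner ℝ (S.psiGradient σ xt z + S.psiGradient σ xt y) (z - y) =
      -(σ / 2) * inner ℝ ((S.shifted σ xt z - S.sparseShrink (S.shifted σ xt z)) -
          (S.shifted σ xt y - S.sparseShrink (S.shifted σ xt y)))
        (S.sparseShrink (S.shifted σ xt y) + S.sparseShrink (S.shifted σ xt z)) := by
    have h3 : (S.shifted σ xt z - S.sparseShrink (S.shifted σ xt z)) -
        (S.shifted σ xt y - S.sparseShrink (S.shifted σ xt y)) =
        -ContinuousLinearMap.adjoint S.A (z - y) -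
        (S.sparseShrink (S.shifted σ xt z) - S.sparseShrink (S.shifted σ xt y)) := by
      rw [← shifted_sub σ xt]; abel
    have h4 : S.psiGradient σ xt z + S.psiGradient σ xt y = S.b + S.b + (z + y) - σ • S.A
        (S.sparseShrink (S.shifted σ xt y) + S.sparseShrink (S.shifted σ xt z)) := by
      simp only [psiGradient, map_add, smul_add]; abel
    rw [h3, h4, hS.psi_eq hσ, hS.psi_eq hσ, inner_sub_left (-_), inner_neg_left,
      ContinuousLinearMap.adjoint_inner_left, inner_sub_left, inner_smul_left,
      real_inner_comm (S.A _) (z - y)]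
    simp only [conj_trivial, inner_add_left, inner_sub_left, inner_add_right, inner_sub_right,
      real_inner_self_eq_norm_sq, map_add]
    rw [real_inner_comm y z,
      real_inner_comm (S.sparseShrink (S.shifted σ xt y)) (S.sparseShrink (S.shifted σ xt z))]
    ring
  have h5 := mul_le_mul_of_nonneg_left h2 (by positivity : 0 ≤ σ / 2)
  linarith

/-! # The Newton system -/

lemma Admissible.inner_newtonOp_comm {σ : ℝ} {u : EuclideanSpace ℝ (Fin n)}
    {M : EuclideanSpace ℝ (Fin n) →L[ℝ] EuclideanSpace ℝ (Fin n)}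
    (hM : M ∈ S.surrogateJacobian u) (x y : EuclideanSpace ℝ (Fin m)) :
    inner ℝ (S.newtonOp σ M x) y = inner ℝ x (S.newtonOp σ M y) := by
  simp only [newtonOp, add_apply, smul_apply, ContinuousLinearMap.id_apply,
    ContinuousLinearMap.comp_apply, inner_add_left, inner_add_right, inner_smul_left,
    inner_smul_right, conj_trivial]
  rw [← ContinuousLinearMap.adjoint_inner_right, hS.inner_surrogate_comm hM,
    ContinuousLinearMap.adjoint_inner_left]

lemma Admissible.sq_norm_le_inner_newtonOp {σ : ℝ} (hσ : 0 < σ) {u : EuclideanSpace ℝ (Fin n)}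
    {M : EuclideanSpace ℝ (Fin n) →L[ℝ] EuclideanSpace ℝ (Fin n)}
    (hM : M ∈ S.surrogateJacobian u) (x : EuclideanSpace ℝ (Fin m)) :
    ‖x‖ ^ 2 ≤ inner ℝ x (S.newtonOp σ M x) := by
  simp only [newtonOp, add_apply, smul_apply, ContinuousLinearMap.id_apply,
    ContinuousLinearMap.comp_apply, inner_add_right, inner_smul_right, real_inner_self_eq_norm_sq]
  rw [← ContinuousLinearMap.adjoint_inner_left]
  have := mul_nonneg hσ.le
    (hS.inner_surrogate_nonneg hM (ContinuousLinearMap.adjoint S.A x))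
  linarith

lemma Admissible.norm_newtonOp_le {σ : ℝ} (hσ : 0 < σ) {u : EuclideanSpace ℝ (Fin n)}
    {M : EuclideanSpace ℝ (Fin n) →L[ℝ] EuclideanSpace ℝ (Fin n)}
    (hM : M ∈ S.surrogateJacobian u) (x : EuclideanSpace ℝ (Fin m)) :
    ‖S.newtonOp σ M x‖ ≤ (1 + σ * (‖S.A‖ * ((1 + g) * ‖S.A‖))) * ‖x‖ := by
  have h1 : ‖S.A (M (ContinuousLinearMap.adjoint S.A x))‖ ≤
      ‖S.A‖ * ((1 + g) * (‖S.A‖ * ‖x‖)) := by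
    refine (S.A.le_opNorm _).trans (mul_le_mul_of_nonneg_left ?_ (norm_nonneg _))
    exact (hS.norm_surrogate_le hM _).trans
      (mul_le_mul_of_nonneg_left (norm_adjoint_le x) (by positivity))
  have h2 := mul_le_mul_of_nonneg_left h1 hσ.le
  simp only [newtonOp, add_apply, smul_apply, ContinuousLinearMap.id_apply,
    ContinuousLinearMap.comp_apply]
  refine (norm_add_le _ _).trans ?_
  rw [norm_smul, Real.norm_of_nonneg hσ.le]
  linarith

/-- The Newton operators that are available at `y`. -/
def newtonOps (S : SGLasso m n g) (σ : ℝ) (xt : EuclideanSpace ℝ (Fin n))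
    (y : EuclideanSpace ℝ (Fin m)) :
    Set (EuclideanSpace ℝ (Fin m) →L[ℝ] EuclideanSpace ℝ (Fin m)) :=
  S.newtonOp σ '' S.surrogateJacobian (S.shifted σ xt y)

lemma Admissible.psiGradient_semismooth {σ : ℝ} (hσ : 0 < σ) (xt : EuclideanSpace ℝ (Fin n))
    (y : EuclideanSpace ℝ (Fin m)) : ∃ C, ∀ᶠ z in 𝓝 y, ∀ V ∈ S.newtonOps σ xt z,
      ‖S.psiGradient σ xt z - S.psiGradient σ xt y - V (z - y)‖ ≤ C * ‖z - y‖ ^ 2 := by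
  obtain ⟨C, hC0, hC⟩ := hS.sparseShrink_semismooth (S.shifted σ xt y)
  refine ⟨σ * (‖S.A‖ * (C * ‖S.A‖ ^ 2)), ?_⟩
  filter_upwards [((continuous_shifted σ xt).tendsto y).eventually hC] with z hz
  rintro V ⟨M, hM, rfl⟩
  have hid : S.psiGradient σ xt z - S.psiGradient σ xt y - S.newtonOp σ M (z - y) =
      -(σ • S.A (S.sparseShrink (S.shifted σ xt z) - S.sparseShrink (S.shifted σ xt y) -
        M (S.shifted σ xt z - S.shifted σ xt y))) := by
    rw [shifted_sub]
    simp only [psiGradient, newtonOp, add_apply, smul_apply, ContinuousLinearMap.id_apply,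
      ContinuousLinearMap.comp_apply, map_neg, map_sub, smul_sub, smul_neg]
    abel
  have h1 := pow_le_pow_left₀ (norm_nonneg _) (S.norm_shifted_sub_le σ xt y z) 2
  rw [mul_pow] at h1
  have h2 := (hz M hM).trans (mul_le_mul_of_nonneg_left h1 hC0)
  have h3 := (S.A.le_opNorm _).trans (mul_le_mul_of_nonneg_left h2 (norm_nonneg S.A))
  have h4 := mul_le_mul_of_nonneg_left h3 hσ.le
  rw [hid, norm_neg, norm_smul, Real.norm_of_nonneg hσ.le]
  linarith

/-- The only use of the origin of d: exact solutions have zero residual, and conjugate gradient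
iterates have an orthogonal one. -/
lemma Admissible.isInexactNewtonDirection {σ : ℝ} (hσ : 0 < σ) {xt : EuclideanSpace ℝ (Fin n)}
    {η τ : ℝ} {y : EuclideanSpace ℝ (Fin m)}
    {M : EuclideanSpace ℝ (Fin n) →L[ℝ] EuclideanSpace ℝ (Fin n)}
    (hM : M ∈ S.surrogateJacobian (S.shifted σ xt y)) {d : EuclideanSpace ℝ (Fin m)}
    (hd : S.IsDirection σ xt η τ y M d) :
    IsInexactNewtonDirection (S.psiGradient σ xt) (1 + σ * (‖S.A‖ * ((1 + g) * ‖S.A‖))) η τ y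
      (S.newtonOp σ M) d := by
  obtain ⟨hd, hacc⟩ := hd
  rw [Accurate, hS.gradient_psi hσ] at hacc
  rw [hS.gradient_psi hσ] at hd
  refine ⟨hS.sq_norm_le_inner_newtonOp hσ hM, hS.norm_newtonOp_le hσ hM, ?_, hacc⟩
  rcases hd with hd | ⟨k, rfl⟩
  · rw [hd, inner_neg_right, real_inner_comm]
  · rw [inner_cgIterate _ (hS.inner_newtonOp_comm hM) (hS.sq_norm_le_inner_newtonOp hσ hM),
      inner_neg_right, real_inner_comm]

/-- Termination of conjugate gradients supplies existence, coercivity uniqueness. -/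
lemma Admissible.existsUnique_newton {σ : ℝ} (hσ : 0 < σ) {u : EuclideanSpace ℝ (Fin n)}
    {M : EuclideanSpace ℝ (Fin n) →L[ℝ] EuclideanSpace ℝ (Fin n)}
    (hM : M ∈ S.surrogateJacobian u) (c : EuclideanSpace ℝ (Fin m)) :
    ∃! d, S.newtonOp σ M d = c := by
  obtain ⟨k, hk⟩ := exists_cgIterate_eq c (hS.inner_newtonOp_comm (σ := σ) hM)
    (hS.sq_norm_le_inner_newtonOp hσ hM)
  refine ⟨_, hk, fun d hd => ?_⟩
  have h := norm_le_of_coercive (hS.sq_norm_le_inner_newtonOp hσ hM)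
    (d - cgIterate (S.newtonOp σ M) c k)
  rw [map_sub, hk, show S.newtonOp σ M d = c from hd, sub_self, norm_zero] at h
  exact sub_eq_zero.mp (norm_le_zero_iff.mp h)

lemma Admissible.exists_accurate_cgIterate {σ : ℝ} (hσ : 0 < σ) {xt : EuclideanSpace ℝ (Fin n)}
    {η τ : ℝ} (hη : 0 ≤ η) {y : EuclideanSpace ℝ (Fin m)}
    {M : EuclideanSpace ℝ (Fin n) →L[ℝ] EuclideanSpace ℝ (Fin n)}
    (hM : M ∈ S.surrogateJacobian (S.shifted σ xt y)) :
    ∃ k, S.Accurate σ xt η τ y M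
      (cgIterate (S.newtonOp σ M) (-gradient (S.psi σ xt) y) k) := by
  obtain ⟨k, hk⟩ := exists_cgIterate_eq (-gradient (S.psi σ xt) y)
    (hS.inner_newtonOp_comm (σ := σ) hM) (hS.sq_norm_le_inner_newtonOp hσ hM)
  refine ⟨k, ?_⟩
  rw [Accurate, hk, neg_add_cancel, norm_zero]
  exact le_min hη (Real.rpow_nonneg (norm_nonneg _) _)

lemma Admissible.exists_armijo {σ : ℝ} (hσ : 0 < σ) {xt : EuclideanSpace ℝ (Fin n)}
    {μ η τ δ : ℝ} (hμ : μ < 1) (hδ : δ ∈ Set.Ioo (0 : ℝ) 1) {y : EuclideanSpace ℝ (Fin m)}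
    {M : EuclideanSpace ℝ (Fin n) →L[ℝ] EuclideanSpace ℝ (Fin n)}
    (hM : M ∈ S.surrogateJacobian (S.shifted σ xt y)) {d : EuclideanSpace ℝ (Fin m)}
    (hd : S.IsDirection σ xt η τ y M d) : ∃ i : ℕ, S.Armijo σ xt μ δ y d i := by
  simp only [Armijo, hS.gradient_psi hσ]
  exact (hS.isInexactNewtonDirection hσ hM hd).exists_armijo
    (hS.stronglyConvexSmooth_psi hσ xt) hμ hδ

lemma Admissible.exists_isNewtonStep {σ : ℝ} (hσ : 0 < σ) (xt : EuclideanSpace ℝ (Fin n))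
    {μ η τ δ : ℝ} (hμ : μ < 1) (hη : 0 ≤ η) (hδ : δ ∈ Set.Ioo (0 : ℝ) 1)
    (y : EuclideanSpace ℝ (Fin m)) : ∃ z, S.IsNewtonStep σ xt μ η τ δ y z := by
  classical
  obtain ⟨M, hM⟩ := hS.surrogateJacobian_nonempty (S.shifted σ xt y)
  obtain ⟨k, hk⟩ := hS.exists_accurate_cgIterate (τ := τ) hσ hη hM
  have hd : S.IsDirection σ xt η τ y M
    (cgIterate (S.newtonOp σ M) (-gradient (S.psi σ xt) y) k) := ⟨Or.inr ⟨k, rfl⟩, hk⟩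
  have hi := hS.exists_armijo hσ hμ hδ hM hd
  exact ⟨_, M, hM, _, hd, Nat.find hi, ⟨Nat.find_spec hi, fun _ h => Nat.find_min' hi h⟩, rfl⟩

lemma Admissible.isDampedNewtonStep {σ : ℝ} (hσ : 0 < σ) {xt : EuclideanSpace ℝ (Fin n)}
    {μ η τ δ : ℝ} {y z : EuclideanSpace ℝ (Fin m)} (h : S.IsNewtonStep σ xt μ η τ δ y z) :
    IsDampedNewtonStep (S.psi σ xt) (S.psiGradient σ xt) (S.newtonOps σ xt)
      (1 + σ * (‖S.A‖ * ((1 + g) * ‖S.A‖))) μ η τ δ y z := by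
  obtain ⟨M, hM, d, hd, i, hi, hz⟩ := h
  simp only [Armijo, hS.gradient_psi hσ] at hi
  exact ⟨_, ⟨M, hM, rfl⟩, d, hS.isInexactNewtonDirection hσ hM hd, i, hi, hz⟩

end Admissible

end SGLasso

end

theorem theorem4p2 {m n g : ℕ} (S : SGLasso m n g) (hS : S.Admissible)
    (σ : ℝ) (hσ : 0 < σ) (xt : EuclideanSpace ℝ (Fin n))
    (μ η τ δ : ℝ) (hμ : μ ∈ Set.Ioo (0 : ℝ) (1 / 2)) (hη : η ∈ Set.Ioo (0 : ℝ) 1)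
    (hτ : τ ∈ Set.Ioc (0 : ℝ) 1) (hδ : δ ∈ Set.Ioo (0 : ℝ) 1) :
    -- the objective is finite and differentiable
    (∀ y, S.psiE σ xt y ≠ ⊤ ∧ S.psiE σ xt y ≠ ⊥) ∧ Differentiable ℝ (S.psi σ xt) ∧
    -- each step of the method can be carried out at every point, for every admissible choice
    (∀ y, (S.surrogateJacobian (S.shifted σ xt y)).Nonempty) ∧
    (∀ y, ∀ M ∈ S.surrogateJacobian (S.shifted σ xt y),
      (∃! d, S.newtonOp σ M d = -gradient (S.psi σ xt) y) ∧
      (∃ k, S.Accurate σ xt η τ y M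
        (cgIterate (S.newtonOp σ M) (-gradient (S.psi σ xt) y) k)) ∧
      (∀ d, S.IsDirection σ xt η τ y M d → ∃ i : ℕ, S.Armijo σ xt μ δ y d i)) ∧
    (∀ y₀, ∃ y : ℕ → EuclideanSpace ℝ (Fin m),
      y 0 = y₀ ∧ S.IsNewtonSequence σ xt μ η τ δ y) ∧
    -- the subproblem has a unique solution, to which every generated sequence converges
    (∃ ybar : EuclideanSpace ℝ (Fin m),
      IsMinOn (S.psi σ xt) Set.univ ybar ∧
      (∀ y, IsMinOn (S.psi σ xt) Set.univ y → y = ybar) ∧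
      ∀ y : ℕ → EuclideanSpace ℝ (Fin m), S.IsNewtonSequence σ xt μ η τ δ y →
        Filter.Tendsto y Filter.atTop (nhds ybar) ∧
        (fun j => ‖y (j + 1) - ybar‖) =O[Filter.atTop] (fun j => ‖y j - ybar‖ ^ (1 + τ))) := by
  have hconv := hS.stronglyConvexSmooth_psi hσ xt
  have hμ1 : μ < 1 := by linarith [hμ.2]
  refine ⟨fun y => ?_, fun y => (hconv.hasGradientAt y).differentiableAt,
    fun y => hS.surrogateJacobian_nonempty _, fun y M hM => ⟨hS.existsUnique_newton hσ hM _,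
      hS.exists_accurate_cgIterate hσ hη.1.le hM, fun d hd => hS.exists_armijo hσ hμ1 hδ hM hd⟩,
    fun y₀ => ?_, ?_⟩
  · rw [hS.psiE_eq hσ]
    exact ⟨EReal.coe_ne_top _, EReal.coe_ne_bot _⟩
  · choose next hnext using hS.exists_isNewtonStep (μ := μ) (τ := τ) hσ xt hμ1 hη.1.le hδ
    refine ⟨fun j => next^[j] y₀, rfl, fun j => ?_⟩
    simp only [Function.iterate_succ_apply']
    exact hnext _
  · obtain ⟨ybar, hmin⟩ := hconv.exists_isMinOn
    have hbar := hconv.gradient_eq_zero_of_isMinOn hmin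
    refine ⟨ybar, hmin, fun y hy => hconv.eq_of_isMinOn hmin hy, fun y hy => ?_⟩
    have hstep := fun j => hS.isDampedNewtonStep hσ (hy j)
    have hlim := tendsto_of_isDampedNewtonStep hconv (by positivity) hμ hη hτ.1 hδ hmin hbar hstep
    exact ⟨hlim, isBigO_of_isDampedNewtonStep hconv hμ hτ hbar
      (hS.psiGradient_semismooth hσ xt ybar) (hS.psi_trapezoid hσ xt ybar) hstep hlim⟩
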